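/- **Model.** There are $n$ parties $p_1,\dots,p_n$ (indices are read modulo $n$). An adversary controls a set of at most $t<n/3$ *byzantine* parties, which behave arbitrarily; the others are *honest*. There is a global clock and a known constant $\Delta>0$. Links are authenticated: an honest party receives only messages that were sent to it by their claimed sender. The adversary controls the scheduling and all message delays, so synchronous, eventually synchronous and asynchronous runs are all included. Signatures are perfect: there are two threshold schemes, with thresholds $t+1$ and $n-t$; a share of an honest party on a message exists only if that party signed the message, a threshold signature on a message exists only if at least threshold many parties have each produced (or, if byzantine, could produce) a share on it, and the valid threshold signature on a message is unique. The thresholds are $t+1$ for HELPREQUEST and for the coin of leader election, and $n-t$ for everything else. $\mathrm{Hash}$ is a fixed function from strings to $\mathbb N$. **Local state.** $LOCK\in\mathbb N\cup\{\bot\}$, $KEY$ (a pair (sq, proof) or $\bot$), $VALUE\in\mathbb V\cup\{\bot\}$, $COMMIT$ (a triple (val, sq, proof) or $\bot$), and $LEADER[sq]$ for every $sq\in\mathbb N$, all initially $\bot$. A *valid key* for $v$ is a pair $(s,\pi)$ such that $\pi$ is a threshold signature on $\langle$PREKEYSTEP$,s,LEADER[s],v\rangle$; a *valid commit certificate* is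 a triple $(v,s,\pi)$ such that $\pi$ is a threshold signature on $\langle$LOCKSTEP$,s,LEADER[s],v\rangle$ (in both cases with $LEADER[s]\neq\bot$). **Linear leader-based view (LBV)** with sequence number $sq$ and leader $\ell$. Each party stores keyProof, lockProof, commitProof (initially $\bot$), active (initially true) and done (initially false), and processes the messages of the instance only after it invoked $\mathsf{startView}(sq,\ell)$. On $\mathsf{startView}$ the leader sends $\langle$PREKEYSTEP$,sq,\ell,VALUE,KEY\rangle$ to all; having collected $n-t$ valid key shares for its $VALUE$ it combines them into $\nu_k$ and sends $\langle$KEYSTEP$,sq,\ell,VALUE,\nu_k\rangle$; having collected $n-t$ valid lock shares it sends $\langle$LOCKSTEP$,sq,\ell,VALUE,\nu_l\rangle$; having collected $n-t$ valid commit shares it sends $\langle$COMMIT$,sq,\ell,VALUE,\nu_c\rangle$. The leader considers only the first share of each kind from each party. While active, a party handles messages from $\ell$ as follows. - PREKEYSTEP with $(v,key)$: if $LOCK=\bot$ or ($key\ne\bot$ and $key.sq\ge LOCK$), and $key=\bot$ or $key$ is a valid key for $v$, it sends $\ell$ its signature share on $\langle$PREKEYSTEP$,sq,\ell,v\rangle$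 (the key share). It issues at most one key share per LBV instance. - KEYSTEP with $(v,\nu)$, $\nu$ a threshold signature on $\langle$PREKEYSTEP$,sq,\ell,v\rangle$: keyProof $\leftarrow(v,\nu)$, and it sends its share on $\langle$KEYSTEP$,sq,\ell,v\rangle$ (the lock share). - LOCKSTEP with $(v,\nu)$, $\nu$ a threshold signature on $\langle$KEYSTEP$,sq,\ell,v\rangle$: lockProof $\leftarrow(v,\nu)$, and it sends its share on $\langle$LOCKSTEP$,sq,\ell,v\rangle$ (the commit share). - COMMIT with $(v,\nu)$, $\nu$ a threshold signature on $\langle$LOCKSTEP$,sq,\ell,v\rangle$: commitProof $\leftarrow(v,\nu)$ and done $\leftarrow$ true. $\mathsf{startView}(sq,\ell)$ returns once done is true (for the leader: after it has also sent all four messages), whereupon the party sends $\langle$YOUR-VIEW-DONE$,sq\rangle$ to $\ell$. $\mathsf{wedgeView}(sq,\ell)$ sets active $\leftarrow$ false and returns (keyProof, lockProof, commitProof). **Auxiliary procedures.** $\mathsf{updateState}(sq,\ell,kp,lp,cp)$: $LEADER[sq]\leftarrow\ell$; if $kp\neq\bot$ then $KEY\leftarrow(sq,kp.proof)$ and $VALUE\leftarrow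 kp.val$; if $lp\ne\bot$ then $LOCK\leftarrow sq$; if $cp\neq\bot$ then $COMMIT\leftarrow(cp.val,sq,cp.proof)$ and **decide** $cp.val$. $\mathsf{check\&updateKey}(key,v)$: if ($KEY=\bot$ or $key.sq>KEY.sq$) and $key$ is a valid key for $v$, then $KEY\leftarrow key$ and $VALUE\leftarrow v$. $\mathsf{check\&updateCommit}(c)$: if $COMMIT=\bot$ and $c$ is a valid commit certificate, then $COMMIT\leftarrow c$ and **decide** $c.val$. $\mathsf{trySynchrony}(sq,\ell,T)$: invoke $\mathsf{startView}(sq,\ell)$ without blocking, wait for time $T$, invoke $\mathsf{wedgeView}(sq,\ell)$ and $\mathsf{updateState}$ with the returned values. $\mathsf{exchangeState}(sq)$: send $\langle$EXCHANGE$,sq,KEY,VALUE,COMMIT\rangle$ to all and wait for $n-t$ EXCHANGE messages for $sq$ from different parties; on every EXCHANGE message run $\mathsf{check\&updateKey}$ and $\mathsf{check\&updateCommit}$ on its content. **Synchronous part.** Run $\mathsf{trySynchrony}(1,p_1,7\Delta)$; then for $j=2,\dots,n$: every party other than $p_j$ runs $\mathsf{trySynchrony}(j,p_j,9\Delta)$,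 while $p_j$, if its $COMMIT=\bot$, sends KEYREQUEST to all, waits for $2\Delta$ and runs $\mathsf{trySynchrony}(j,p_j,7\Delta)$, and otherwise does nothing. On the first KEYREQUEST of a party, reply $\langle$KEYREPLY$,KEY,VALUE\rangle$; on KEYREPLY run $\mathsf{check\&updateKey}$. **$\mathsf{help\&tryHalting}(sq)$.** If $COMMIT=\bot$, send $\langle$HELPREQUEST$,sq\rangle$ with a signature share on it to all; in any case block until a valid $\langle$COMPLAIN$,sq,\nu\rangle$ is received, where $\nu$ is a threshold signature on $\langle$HELPREQUEST$,sq\rangle$. On a valid HELPREQUEST, store the share and reply $\langle$HELPREPLY$,sq,COMMIT\rangle$; when $t+1$ shares for $sq$ are stored, combine them and send COMPLAIN to all. On a valid COMPLAIN, forward it to all. On HELPREPLY run $\mathsf{check\&updateCommit}$. **$\mathsf{wave}(sq)$.** Invoke $\mathsf{startView}(sq,p_j)$ for all $j=1,\dots,n$ without blocking and block until a valid BARRIERREADY for $sq$ is received. Then send a signature share on the coin of $sq$ to all, wait for $t+1$ valid coin shares, combine them into $\nu$, let the leader be $p_j$ with $j=\mathrm{Hash}(\nu)\bmod n$, invoke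 $\mathsf{wedgeView}(sq,p_j)$ and $\mathsf{updateState}$ with the returned values. Barrier: on $n-t$ YOUR-VIEW-DONE messages for $sq$ from different parties, send a signature share on $\langle$SHAREREADY$,sq\rangle$ to all; on $n-t$ valid such shares, combine them and send the result in a BARRIERREADY message to all; on a valid BARRIERREADY, forward it to all. **Fallback** from $sq=n+2$, with $r=1$: repeat $\mathsf{wave}(sq)$, $\mathsf{exchangeState}(sq)$, $\mathsf{help\&tryHalting}(sq)$, $\mathsf{trySynchrony}(sq+1,p_r,8\Delta)$, $\mathsf{exchangeState}(sq+1)$, $\mathsf{help\&tryHalting}(sq+1)$, $r\leftarrow (r+1)\bmod n$, $sq\leftarrow sq+2$. **Optimistic protocol.** On proposing $v$: $VALUE\leftarrow v$; run the synchronous part; run $\mathsf{help\&tryHalting}(n+1)$; run the fallback from $n+2$. All message handlers run concurrently with the main thread. A party that waits, for a time or for an event, may continue at any moment from then on. **Statement (Agreement).** For all $n$ and $t$ with $3t<n$, every set of at most $t$ byzantine parties, and every run of the optimistic protocol: if an honest party $p$ decides $v$ and an honest party $q$ decides $w$ (at any times, anywhere in the protocol, possibly $p=q$), then $v=w$. 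-/

import Mathlib

namespace OptimisticBA

universe u

/-! ### Perfect signatures, messages -/

/-- The two threshold signature schemes: in `low` a signature needs `t + 1` shares, in `high` it
needs `n - t` shares. -/
inductive Scheme : Type
  | low
  | high

/-- The statements that parties sign.  The parties are the elements of `Fin n`. -/
inductive Stmt (n : ℕ) (V : Type u) : Type u
  | preKeyStep (sq : ℕ) (leader : Fin n) (value : V)
  | keyStep (sq : ℕ) (leader : Fin n) (value : V)
  | lockStep (sq : ℕ) (leader : Fin n) (value : V)
  | helpRequest (sq : ℕ)
  | shareReady (sq : ℕ)
  | coin (sq : ℕ)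

/-- Signature strings, symbolically: the share of `signer` on `m`, the (unique) valid threshold
signature on `m`, or a string that is neither. -/
inductive Sig (n : ℕ) (V : Type u) : Type u
  | share (c : Scheme) (signer : Fin n) (m : Stmt n V)
  | full (c : Scheme) (m : Stmt n V)
  | junk (w : List Bool)

/-- A key: a sequence number and a proof. -/
abbrev Key (n : ℕ) (V : Type u) : Type u := ℕ × Sig n V

/-- A commit certificate as stored in `COMMIT`: value, sequence number, proof. -/
abbrev Cert (n : ℕ) (V : Type u) : Type u := V × ℕ × Sig n V

/-- The messages of the protocol; `none` stands for `⊥`. -/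
inductive Msg (n : ℕ) (V : Type u) : Type u
  | preKeyStep (sq : ℕ) (leader : Fin n) (value : V) (key : Option (Key n V))
  | keyShare (sq : ℕ) (leader : Fin n) (ρ : Sig n V)
  | keyStep (sq : ℕ) (leader : Fin n) (value : V) (ν : Sig n V)
  | lockShare (sq : ℕ) (leader : Fin n) (ρ : Sig n V)
  | lockStep (sq : ℕ) (leader : Fin n) (value : V) (ν : Sig n V)
  | commitShare (sq : ℕ) (leader : Fin n) (ρ : Sig n V)
  | commit (sq : ℕ) (leader : Fin n) (value : V) (ν : Sig n V)
  | keyRequest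
  | keyReply (key : Option (Key n V)) (value : Option V)
  | yourViewDone (sq : ℕ)
  | exchange (sq : ℕ) (key : Option (Key n V)) (value : Option V) (cert : Option (Cert n V))
  | helpRequest (sq : ℕ) (ρ : Sig n V)
  | helpReply (sq : ℕ) (cert : Option (Cert n V))
  | complain (sq : ℕ) (ν : Sig n V)
  | shareReady (sq : ℕ) (ρ : Sig n V)
  | barrierReady (sq : ℕ) (ν : Sig n V)
  | coinShare (sq : ℕ) (ρ : Sig n V)

/-- The signature strings that occur in a message. -/
def Msg.sigs {n : ℕ} {V : Type u} : Msg n V → Set (Sig n V)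
  | .preKeyStep _ _ _ key => {x | ∃ k ∈ key, x = k.2}
  | .keyShare _ _ ρ => {ρ}
  | .keyStep _ _ _ ν => {ν}
  | .lockShare _ _ ρ => {ρ}
  | .lockStep _ _ _ ν => {ν}
  | .commitShare _ _ ρ => {ρ}
  | .commit _ _ _ ν => {ν}
  | .keyRequest => ∅
  | .keyReply key _ => {x | ∃ k ∈ key, x = k.2}
  | .yourViewDone _ => ∅
  | .exchange _ key _ cert => {x | ∃ k ∈ key, x = k.2} ∪ {x | ∃ c ∈ cert, x = c.2.2}
  | .helpRequest _ ρ => {ρ}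
  | .helpReply _ cert => {x | ∃ c ∈ cert, x = c.2.2}
  | .complain _ ν => {ν}
  | .shareReady _ ρ => {ρ}
  | .barrierReady _ ν => {ν}
  | .coinShare _ ρ => {ρ}

/-- The parameters of the protocol: `n` parties, at most `t < n / 3` of them byzantine, the delay
bound `Δ`, and the hash function that leader election applies to a threshold signature. -/
structure Params (V : Type u) where
  n : ℕ
  t : ℕ
  three_mul_t_lt : 3 * t < n
  Δ : ℝ
  Δ_pos : 0 < Δ
  hash : Sig n V → ℕ

section Protocol

variable {V : Type u} (P : Params V)

/-- The number of shares that make a threshold signature. -/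
def Params.threshold : Scheme → ℕ
  | .low => P.t + 1
  | .high => P.n - P.t

/-- The party with index `j`: the parties are `p_1, …, p_n` and indices are read modulo `n`, so
that `p_0` is `p_n`. -/
def Params.p (j : ℕ) : Fin P.n :=
  ⟨(j + P.n - 1) % P.n, Nat.mod_lt _ (Nat.lt_of_le_of_lt (Nat.zero_le _) P.three_mul_t_lt)⟩

/-- Party `j` accepts `ρ` as its share on `m`. -/
def shareValidate {n : ℕ} (c : Scheme) (m : Stmt n V) (j : Fin n) (ρ : Sig n V) : Prop :=
  ρ = .share c j m

/-- `ν` is a valid threshold signature on `m`. -/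
def thresholdValidate {n : ℕ} (c : Scheme) (m : Stmt n V) (ν : Sig n V) : Prop :=
  ν = .full c m

open Classical in
/-- Combine a set of shares: when it has enough shares on one statement, the result is the
threshold signature on that statement, otherwise a worthless string. -/
noncomputable def thresholdSign (c : Scheme) (S : Set (Sig P.n V)) : Sig P.n V :=
  if h : ∃ m, P.threshold c ≤ {i | Sig.share c i m ∈ S}.ncard then .full c h.choose else .junk []

/-! ### Local states -/

/-- What one party stores about the LBV instance with a given sequence number and leader.
`started` says that `startView` was invoked, `returned` that it returned.  `sentKeyShare` says that
the party already issued its key share.  The sets `heard…` hold the parties whose share was already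
received, and `stage` counts the step messages that the party sent as the leader. -/
structure LBV (n : ℕ) (V : Type u) where
  started : Bool
  active : Bool
  done : Bool
  returned : Bool
  keyProof : Option (V × Sig n V)
  lockProof : Option (V × Sig n V)
  commitProof : Option (V × Sig n V)
  sentKeyShare : Bool
  heardKey : Set (Fin n)
  heardLock : Set (Fin n)
  heardCommit : Set (Fin n)
  Skey : Set (Sig n V)
  Slock : Set (Sig n V)
  Scommit : Set (Sig n V)
  stage : ℕ

/-- The initial state of an LBV instance. -/
def LBV.init (n : ℕ) (V : Type u) : LBV n V where
  started := false
  active := true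
  done := false
  returned := false
  keyProof := none
  lockProof := none
  commitProof := none
  sentKeyShare := false
  heardKey := ∅
  heardLock := ∅
  heardCommit := ∅
  Skey := ∅
  Slock := ∅
  Scommit := ∅
  stage := 0

/-- Where the main thread of a party stands (the places where it may have to wait).
In the last group `sq` is the sequence number of the current wave, `rr` is `RRleader`. -/
inductive Loc : Type
  /-- has not proposed yet -/
  | idle
  /-- synchronous part, beginning of the `j`-th iteration -/
  | syncTop (j : ℕ)
  /-- waiting for key replies until `deadline`, as the leader of the `j`-th LBV -/
  | keyWait (j : ℕ) (deadline : ℝ)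
  /-- waiting until `deadline` in the `j`-th LBV -/
  | syncView (j : ℕ) (deadline : ℝ)
  /-- waiting in `help&tryHalting(n+1)` -/
  | syncHelp
  /-- fallback, beginning of an iteration -/
  | waveTop (sq rr : ℕ)
  /-- waiting in `barrier-sync(sq)` -/
  | barrier (sq rr : ℕ)
  /-- waiting in `elect(sq)` -/
  | elect (sq rr : ℕ)
  /-- waiting in `exchangeState(sq)` -/
  | waveExchange (sq rr : ℕ)
  /-- waiting in `help&tryHalting(sq)` -/
  | waveHelp (sq rr : ℕ)
  /-- waiting until `deadline` in the LBV with sequence number `sq + 1` -/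
  | rrView (sq rr : ℕ) (deadline : ℝ)
  /-- waiting in `exchangeState(sq+1)` -/
  | rrExchange (sq rr : ℕ)
  /-- waiting in `help&tryHalting(sq+1)` -/
  | rrHelp (sq rr : ℕ)

/-- The local state of a party.  `decisions` collects the values on which it decided. -/
structure PState (n : ℕ) (V : Type u) where
  loc : Loc
  LOCK : Option ℕ
  KEY : Option (Key n V)
  VALUE : Option V
  COMMIT : Option (Cert n V)
  LEADER : ℕ → Option (Fin n)
  lbv : ℕ → Fin n → LBV n V
  keyRequested : Set (Fin n)
  viewDone : ℕ → Set (Fin n)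
  Sbarrier : ℕ → Set (Sig n V)
  READY : ℕ → Bool
  Scoin : ℕ → Set (Sig n V)
  exchanged : ℕ → Set (Fin n)
  Shelp : ℕ → Set (Sig n V)
  HALT : ℕ → Bool
  decisions : Set V

/-- The initial local state. -/
def PState.init (n : ℕ) (V : Type u) : PState n V where
  loc := .idle
  LOCK := none
  KEY := none
  VALUE := none
  COMMIT := none
  LEADER := fun _ => none
  lbv := fun _ _ => LBV.init n V
  keyRequested := ∅
  viewDone := fun _ => ∅
  Sbarrier := fun _ => ∅
  READY := fun _ => false
  Scoin := fun _ => ∅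
  exchanged := fun _ => ∅
  Shelp := fun _ => ∅
  HALT := fun _ => true
  decisions := ∅

/-- Overwrite the record of one LBV instance. -/
def PState.setLBV {n : ℕ} (s : PState n V) (sq : ℕ) (l : Fin n) (b : LBV n V) : PState n V :=
  { s with lbv := Function.update s.lbv sq (Function.update (s.lbv sq) l b) }

/-- Messages to be sent, with their destinations. -/
abbrev Outbox (n : ℕ) (V : Type u) : Type u := Set (Fin n × Msg n V)

/-- Send `m` to all parties (the sender included). -/
def toAll {n : ℕ} (m : Msg n V) : Outbox n V := {e | e.2 = m}

/-- Send `m` to party `j`. -/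
def toOne {n : ℕ} (j : Fin n) (m : Msg n V) : Outbox n V := {(j, m)}

/-! ### Auxiliary procedures -/

/-- Procedure `updateState`. -/
def updateState {n : ℕ} (sq : ℕ) (leader : Fin n)
    (keyProof lockProof commitProof : Option (V × Sig n V)) (s : PState n V) : PState n V :=
  { s with
    LEADER := Function.update s.LEADER sq (some leader)
    KEY := match keyProof with
      | some (_, π) => some (sq, π)
      | none => s.KEY
    VALUE := match keyProof with
      | some (v, _) => some v
      | none => s.VALUE
    LOCK := match lockProof with
      | some _ => some sq
      | none => s.LOCK
    COMMIT := match commitProof with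
      | some (v, π) => some (v, sq, π)
      | none => s.COMMIT
    decisions := match commitProof with
      | some (v, _) => insert v s.decisions
      | none => s.decisions }

/-- `key` is a valid key for `value`, judged with the local `LEADER` table (a sequence number whose
leader is not known has no valid key, and neither `⊥` is a valid key). -/
def validKey {n : ℕ} (s : PState n V) (key : Option (Key n V)) (value : V) : Prop :=
  ∃ sq π l, key = some (sq, π) ∧ s.LEADER sq = some l ∧
    thresholdValidate .high (.preKeyStep sq l value) π

/-- `cert` is a valid commit certificate, judged with the local `LEADER` table. -/
def validCert {n : ℕ} (s : PState n V) (cert : Cert n V) : Prop :=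
  ∃ l, s.LEADER cert.2.1 = some l ∧
    thresholdValidate .high (.lockStep cert.2.1 l cert.1) cert.2.2

open Classical in
/-- Procedure `check&updateKey`. -/
noncomputable def checkUpdateKey {n : ℕ} (key : Option (Key n V)) (value : Option V)
    (s : PState n V) : PState n V :=
  if (∀ k₀ ∈ s.KEY, ∃ k ∈ key, k₀.1 < k.1) ∧ (∃ v ∈ value, validKey s key v) then
    { s with KEY := key, VALUE := value }
  else s

open Classical in
/-- Procedure `check&updateCommit`. -/
noncomputable def checkUpdateCommit {n : ℕ} (cert : Option (Cert n V)) (s : PState n V) :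
    PState n V :=
  match cert with
  | none => s
  | some c =>
    if s.COMMIT = none ∧ validCert s c then
      { s with COMMIT := some c, decisions := insert c.1 s.decisions }
    else s

/-! ### Linear LBV: the interface -/

open Classical in
/-- Party `i` invokes `startView(sq, l)` for every `l ∈ L` (the effect on its state). -/
noncomputable def startViews {n : ℕ} (i : Fin n) (sq : ℕ) (L : Set (Fin n)) (s : PState n V) :
    PState n V :=
  { s with
    lbv := Function.update s.lbv sq fun l =>
      if l ∈ L then
        { s.lbv sq l with
          started := true
          stage := if l = i then 1 else (s.lbv sq l).stage }
      else s.lbv sq l }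

/-- The messages sent by party `i` when it invokes `startView(sq, l)` for every `l ∈ L`: its
first-step message, if it is one of the leaders. -/
def startOut {n : ℕ} (i : Fin n) (sq : ℕ) (L : Set (Fin n)) (s : PState n V) : Outbox n V :=
  {e | i ∈ L ∧ ∃ v, s.VALUE = some v ∧ e.2 = .preKeyStep sq i v s.KEY}

/-- `wedgeView(sq, l)` followed by `updateState` with the returned values. -/
def wedgeAndUpdate {n : ℕ} (sq : ℕ) (l : Fin n) (s : PState n V) : PState n V :=
  updateState sq l (s.lbv sq l).keyProof (s.lbv sq l).lockProof (s.lbv sq l).commitProof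
    (s.setLBV sq l { s.lbv sq l with active := false })

/-! ### Message handlers -/

/-- The first step's key is up-to-date: the party is not locked, or the key is at least as recent
as its lock. -/
def keyUpToDate {n : ℕ} (s : PState n V) (key : Option (Key n V)) : Prop :=
  ∀ lk ∈ s.LOCK, ∃ k ∈ key, lk ≤ k.1

open Classical in
/-- Party `i` handles the message `m` received from `src`: the new local state and the messages
sent in response. -/
noncomputable def receive (i src : Fin P.n) (m : Msg P.n V) (s : PState P.n V) :
    PState P.n V × Outbox P.n V :=
  match m with
  | .preKeyStep sq l v key =>
    let b := s.lbv sq l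
    if src = l ∧ b.started ∧ b.active ∧ b.sentKeyShare = false ∧ keyUpToDate s key ∧
        (key = none ∨ validKey s key v) then
      (s.setLBV sq l { b with sentKeyShare := true },
        toOne l (.keyShare sq l (.share .high i (.preKeyStep sq l v))))
    else (s, ∅)
  | .keyShare sq l ρ =>
    let b := s.lbv sq l
    if l = i ∧ b.started ∧ src ∉ b.heardKey then
      if ∃ v ∈ s.VALUE, shareValidate .high (.preKeyStep sq l v) src ρ then
        (s.setLBV sq l { b with heardKey := insert src b.heardKey, Skey := insert ρ b.Skey }, ∅)
      else (s.setLBV sq l { b with heardKey := insert src b.heardKey }, ∅)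
    else (s, ∅)
  | .keyStep sq l v ν =>
    let b := s.lbv sq l
    if src = l ∧ b.started ∧ b.active ∧ thresholdValidate .high (.preKeyStep sq l v) ν then
      (s.setLBV sq l { b with keyProof := some (v, ν) },
        toOne l (.lockShare sq l (.share .high i (.keyStep sq l v))))
    else (s, ∅)
  | .lockShare sq l ρ =>
    let b := s.lbv sq l
    if l = i ∧ b.started ∧ src ∉ b.heardLock then
      if ∃ v ∈ s.VALUE, shareValidate .high (.keyStep sq l v) src ρ then
        (s.setLBV sq l { b with heardLock := insert src b.heardLock, Slock := insert ρ b.Slock }, ∅)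
      else (s.setLBV sq l { b with heardLock := insert src b.heardLock }, ∅)
    else (s, ∅)
  | .lockStep sq l v ν =>
    let b := s.lbv sq l
    if src = l ∧ b.started ∧ b.active ∧ thresholdValidate .high (.keyStep sq l v) ν then
      (s.setLBV sq l { b with lockProof := some (v, ν) },
        toOne l (.commitShare sq l (.share .high i (.lockStep sq l v))))
    else (s, ∅)
  | .commitShare sq l ρ =>
    let b := s.lbv sq l
    if l = i ∧ b.started ∧ src ∉ b.heardCommit then
      if ∃ v ∈ s.VALUE, shareValidate .high (.lockStep sq l v) src ρ then
        (s.setLBV sq l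
          { b with heardCommit := insert src b.heardCommit, Scommit := insert ρ b.Scommit }, ∅)
      else (s.setLBV sq l { b with heardCommit := insert src b.heardCommit }, ∅)
    else (s, ∅)
  | .commit sq l v ν =>
    let b := s.lbv sq l
    if src = l ∧ b.started ∧ b.active ∧ thresholdValidate .high (.lockStep sq l v) ν then
      (s.setLBV sq l { b with commitProof := some (v, ν), done := true }, ∅)
    else (s, ∅)
  | .keyRequest =>
    if src ∉ s.keyRequested then
      ({ s with keyRequested := insert src s.keyRequested }, toOne src (.keyReply s.KEY s.VALUE))
    else (s, ∅)
  | .keyReply key value => (checkUpdateKey key value s, ∅)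
  | .yourViewDone sq =>
    ({ s with viewDone := Function.update s.viewDone sq (insert src (s.viewDone sq)) }, ∅)
  | .exchange sq key value cert =>
    let s' := checkUpdateCommit cert (checkUpdateKey key value s)
    ({ s' with exchanged := Function.update s'.exchanged sq (insert src (s'.exchanged sq)) }, ∅)
  | .helpRequest sq ρ =>
    if shareValidate .low (.helpRequest sq) src ρ then
      let S := insert ρ (s.Shelp sq)
      ({ s with Shelp := Function.update s.Shelp sq S },
        toOne src (.helpReply sq s.COMMIT) ∪
          if S.ncard = P.t + 1 then toAll (.complain sq (thresholdSign P .low S)) else ∅)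
    else (s, ∅)
  | .helpReply _ cert => (checkUpdateCommit cert s, ∅)
  | .complain sq ν =>
    if thresholdValidate .low (.helpRequest sq) ν then
      ({ s with HALT := Function.update s.HALT sq false }, toAll (.complain sq ν))
    else (s, ∅)
  | .shareReady sq ρ =>
    if shareValidate .high (.shareReady sq) src ρ then
      let S := insert ρ (s.Sbarrier sq)
      ({ s with Sbarrier := Function.update s.Sbarrier sq S },
        if S.ncard = P.n - P.t then toAll (.barrierReady sq (thresholdSign P .high S)) else ∅)
    else (s, ∅)
  | .barrierReady sq ν =>
    if thresholdValidate .high (.shareReady sq) ν then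
      ({ s with READY := Function.update s.READY sq true }, toAll (.barrierReady sq ν))
    else (s, ∅)
  | .coinShare sq ρ =>
    if shareValidate .low (.coin sq) src ρ then
      ({ s with Scoin := Function.update s.Scoin sq (insert ρ (s.Scoin sq)) }, ∅)
    else (s, ∅)

/-! ### The threads of a party -/

/-- The message that `exchangeState(sq)` sends to all parties. -/
def exchangeOut {n : ℕ} (sq : ℕ) (s : PState n V) : Outbox n V :=
  toAll (.exchange sq s.KEY s.VALUE s.COMMIT)

/-- The messages that party `i` sends on entering `help&tryHalting(sq)`. -/
def helpOut {n : ℕ} (i : Fin n) (sq : ℕ) (s : PState n V) : Outbox n V :=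
  {e | s.COMMIT = none ∧ e.2 = .helpRequest sq (.share .low i (.helpRequest sq))}

/-- The leader that `elect(sq)` returns when the shares in `Scoin` are combined. -/
noncomputable def elected (sq : ℕ) (s : PState P.n V) : Fin P.n :=
  P.p (P.hash (thresholdSign P .low (s.Scoin sq)) % P.n)

/-- `ThreadStep P i now s s' out`: at time `now` party `i` runs one of its threads from one waiting
place to the next, moving from `s` to `s'` and sending `out`.  A thread that waited for some time or
for some event may go on at any moment from then on. -/
inductive ThreadStep (i : Fin P.n) (now : ℝ) :
    PState P.n V → PState P.n V → Outbox P.n V → Prop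
  -- the optimistic protocol, up to the start of the synchronous part
  | propose (s : PState P.n V) (v : V) (h : s.loc = .idle) :
      ThreadStep i now s { s with VALUE := some v, loc := .syncTop 1 } ∅
  -- the synchronous part
  | syncStart (s : PState P.n V) (j : ℕ) (h : s.loc = .syncTop j) (hj : j ≤ P.n)
      (hi : j = 1 ∨ P.p j ≠ i) :
      ThreadStep i now s
        { startViews i j {P.p j} s with
          loc := .syncView j (now + (if j = 1 then 7 else 9) * P.Δ) }
        (startOut i j {P.p j} s)
  | keyRequest (s : PState P.n V) (j : ℕ) (h : s.loc = .syncTop j) (hj : j ≤ P.n)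
      (hi : j ≠ 1 ∧ P.p j = i) (hc : s.COMMIT = none) :
      ThreadStep i now s { s with loc := .keyWait j (now + 2 * P.Δ) } (toAll .keyRequest)
  | syncSkip (s : PState P.n V) (j : ℕ) (h : s.loc = .syncTop j) (hj : j ≤ P.n)
      (hi : j ≠ 1 ∧ P.p j = i) (hc : s.COMMIT ≠ none) :
      ThreadStep i now s { s with loc := .syncTop (j + 1) } ∅
  | keyWaitEnd (s : PState P.n V) (j : ℕ) (d : ℝ) (h : s.loc = .keyWait j d) (hd : d ≤ now) :
      ThreadStep i now s
        { startViews i j {P.p j} s with loc := .syncView j (now + 7 * P.Δ) }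
        (startOut i j {P.p j} s)
  | syncWedge (s : PState P.n V) (j : ℕ) (d : ℝ) (h : s.loc = .syncView j d) (hd : d ≤ now) :
      ThreadStep i now s { wedgeAndUpdate j (P.p j) s with loc := .syncTop (j + 1) } ∅
  | syncEnd (s : PState P.n V) (h : s.loc = .syncTop (P.n + 1)) :
      ThreadStep i now s { s with loc := .syncHelp } (helpOut i (P.n + 1) s)
  | syncHelpEnd (s : PState P.n V) (h : s.loc = .syncHelp) (hh : s.HALT (P.n + 1) = false) :
      ThreadStep i now s { s with loc := .waveTop (P.n + 2) 1 } ∅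
  -- the fallback: the wave with sequence number `sq`
  | waveStart (s : PState P.n V) (sq rr : ℕ) (h : s.loc = .waveTop sq rr) :
      ThreadStep i now s
        { startViews i sq Set.univ s with loc := .barrier sq rr }
        (startOut i sq Set.univ s)
  | barrierEnd (s : PState P.n V) (sq rr : ℕ) (h : s.loc = .barrier sq rr)
      (hr : s.READY sq = true) :
      ThreadStep i now s { s with loc := .elect sq rr }
        (toAll (.coinShare sq (.share .low i (.coin sq))))
  | electEnd (s s' : PState P.n V) (sq rr : ℕ) (h : s.loc = .elect sq rr)
      (hc : P.t + 1 ≤ (s.Scoin sq).ncard)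
      (hs : s' = { wedgeAndUpdate sq (elected P sq s) s with loc := .waveExchange sq rr }) :
      ThreadStep i now s s' (exchangeOut sq s')
  | waveExchangeEnd (s : PState P.n V) (sq rr : ℕ) (h : s.loc = .waveExchange sq rr)
      (he : P.n - P.t ≤ (s.exchanged sq).ncard) :
      ThreadStep i now s { s with loc := .waveHelp sq rr } (helpOut i sq s)
  -- the fallback: the LBV with sequence number `sq + 1` and leader `RRleader`
  | rrStart (s : PState P.n V) (sq rr : ℕ) (h : s.loc = .waveHelp sq rr)
      (hh : s.HALT sq = false) :
      ThreadStep i now s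
        { startViews i (sq + 1) {P.p rr} s with loc := .rrView sq rr (now + 8 * P.Δ) }
        (startOut i (sq + 1) {P.p rr} s)
  | rrWedge (s s' : PState P.n V) (sq rr : ℕ) (d : ℝ) (h : s.loc = .rrView sq rr d) (hd : d ≤ now)
      (hs : s' = { wedgeAndUpdate (sq + 1) (P.p rr) s with loc := .rrExchange sq rr }) :
      ThreadStep i now s s' (exchangeOut (sq + 1) s')
  | rrExchangeEnd (s : PState P.n V) (sq rr : ℕ) (h : s.loc = .rrExchange sq rr)
      (he : P.n - P.t ≤ (s.exchanged (sq + 1)).ncard) :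
      ThreadStep i now s { s with loc := .rrHelp sq rr } (helpOut i (sq + 1) s)
  | rrHelpEnd (s : PState P.n V) (sq rr : ℕ) (h : s.loc = .rrHelp sq rr)
      (hh : s.HALT (sq + 1) = false) :
      ThreadStep i now s { s with loc := .waveTop (sq + 2) ((rr + 1) % P.n) } ∅
  -- an invocation of `startView` by the leader `i`: the steps after the first message
  | leaderKeyStep (s : PState P.n V) (sq : ℕ) (v : V) (h : (s.lbv sq i).stage = 1)
      (hS : P.n - P.t ≤ (s.lbv sq i).Skey.ncard) (hv : s.VALUE = some v) :
      ThreadStep i now s (s.setLBV sq i { s.lbv sq i with stage := 2 })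
        (toAll (.keyStep sq i v (thresholdSign P .high (s.lbv sq i).Skey)))
  | leaderLockStep (s : PState P.n V) (sq : ℕ) (v : V) (h : (s.lbv sq i).stage = 2)
      (hS : P.n - P.t ≤ (s.lbv sq i).Slock.ncard) (hv : s.VALUE = some v) :
      ThreadStep i now s (s.setLBV sq i { s.lbv sq i with stage := 3 })
        (toAll (.lockStep sq i v (thresholdSign P .high (s.lbv sq i).Slock)))
  | leaderCommit (s : PState P.n V) (sq : ℕ) (v : V) (h : (s.lbv sq i).stage = 3)
      (hS : P.n - P.t ≤ (s.lbv sq i).Scommit.ncard) (hv : s.VALUE = some v) :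
      ThreadStep i now s (s.setLBV sq i { s.lbv sq i with stage := 4 })
        (toAll (.commit sq i v (thresholdSign P .high (s.lbv sq i).Scommit)))
  -- `startView(sq, l)` returns
  | viewReturns (s : PState P.n V) (sq : ℕ) (l : Fin P.n) (hs : (s.lbv sq l).started = true)
      (hd : (s.lbv sq l).done = true) (hr : (s.lbv sq l).returned = false)
      (hl : l = i → (s.lbv sq l).stage = 4) :
      ThreadStep i now s (s.setLBV sq l { s.lbv sq l with returned := true })
        (toOne l (.yourViewDone sq))
  -- `n - t` messages `yourViewDone sq` were received: `barrier-ready(sq)`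
  | barrierReady (s : PState P.n V) (sq : ℕ) (h : P.n - P.t ≤ (s.viewDone sq).ncard) :
      ThreadStep i now s s (toAll (.shareReady sq (.share .high i (.shareReady sq))))

/-! ### Runs -/

/-- A message with its sender and its receiver. -/
abbrev Envelope (n : ℕ) (V : Type u) : Type u := Fin n × Fin n × Msg n V

/-- A global state: the clock, the local states of the parties (those of byzantine parties mean
nothing), and all the messages sent so far. -/
structure GState (n : ℕ) (V : Type u) where
  now : ℝ
  party : Fin n → PState n V
  sent : Set (Envelope n V)

/-- The initial global state. -/
def GState.init (n : ℕ) (V : Type u) : GState n V where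
  now := 0
  party := fun _ => PState.init n V
  sent := ∅

/-- Put a new local state of party `i` and its outgoing messages into the global state. -/
def GState.apply {n : ℕ} (g : GState n V) (i : Fin n) (s : PState n V) (out : Outbox n V) :
    GState n V :=
  { g with
    party := Function.update g.party i s
    sent := g.sent ∪ {e | e.1 = i ∧ e.2 ∈ out} }

/-- The signature strings available to an adversary that controls the parties in `byz` and sees
all the messages in `sent`.  Signatures are perfect: a share of an honest party is available only
after that party issued it, and a threshold signature only after enough shares are available. -/
inductive Available (byz : Finset (Fin P.n)) (sent : Set (Envelope P.n V)) : Sig P.n V → Prop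
  | seen (e : Envelope P.n V) (he : e ∈ sent) (x : Sig P.n V) (hx : x ∈ e.2.2.sigs) :
      Available byz sent x
  | own (c : Scheme) (i : Fin P.n) (hi : i ∈ byz) (m : Stmt P.n V) :
      Available byz sent (.share c i m)
  | combine (c : Scheme) (m : Stmt P.n V) (Q : Finset (Fin P.n)) (hQ : P.threshold c ≤ Q.card)
      (h : ∀ i ∈ Q, Available byz sent (.share c i m)) : Available byz sent (.full c m)
  | junk (w : List Bool) : Available byz sent (.junk w)

/-- One step of a run in which the parties in `byz` are byzantine. -/
inductive Step (byz : Finset (Fin P.n)) : GState P.n V → GState P.n V → Prop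
  /-- Time passes (possibly none). -/
  | tick (g : GState P.n V) (d : ℝ) (hd : 0 ≤ d) : Step byz g { g with now := g.now + d }
  /-- An honest party receives a message that was sent to it. -/
  | deliver (g : GState P.n V) (src i : Fin P.n) (m : Msg P.n V) (hi : i ∉ byz)
      (hm : (src, i, m) ∈ g.sent) :
      Step byz g (g.apply i (receive P i src m (g.party i)).1 (receive P i src m (g.party i)).2)
  /-- An honest party continues one of its threads. -/
  | thread (g : GState P.n V) (i : Fin P.n) (s' : PState P.n V) (out : Outbox P.n V) (hi : i ∉ byz)
      (h : ThreadStep P i g.now (g.party i) s' out) : Step byz g (g.apply i s' out)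
  /-- A byzantine party sends an arbitrary message made of available signatures. -/
  | byzantine (g : GState P.n V) (b dst : Fin P.n) (m : Msg P.n V) (hb : b ∈ byz)
      (h : ∀ x ∈ m.sigs, Available P byz g.sent x) :
      Step byz g { g with sent := insert (b, dst, m) g.sent }

/-- A run: an infinite sequence of steps from the initial state.  The adversary schedules the
steps; nothing is assumed about delays, so that synchronous, eventually synchronous and asynchronous
runs are all covered. -/
def IsRun (byz : Finset (Fin P.n)) (r : ℕ → GState P.n V) : Prop :=
  r 0 = GState.init P.n V ∧ ∀ k, Step P byz (r k) (r (k + 1))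

/-- Party `i` decides `v` (at some time) in the run `r`. -/
def Decides {n : ℕ} (r : ℕ → GState n V) (i : Fin n) (v : V) : Prop :=
  ∃ k, v ∈ ((r k).party i).decisions

/-- The Agreement property of a run: all honest parties that decide, decide on the same value. -/
def Agreement {n : ℕ} (byz : Finset (Fin n)) (r : ℕ → GState n V) : Prop :=
  ∀ i ∉ byz, ∀ j ∉ byz, ∀ v w, Decides r i v → Decides r j w → v = w

end Protocol

end OptimisticBA

namespace OptimisticBA

universe u

variable {V : Type u} {P : Params V}

/-! Call the `high` threshold signature on `preKeyStep sq l v` a key for `v`, and the one on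
`lockStep sq l v` a commit certificate for `v`. Every decision rests on a commit certificate. Timing
plays no role: the argument compares views only through their sequence numbers.

Honest parties agree on the leader of each sequence number. In the synchronous and round-robin views
it is prescribed; in a wave it is a hash of the coin signature, which is unique. So it is a function
`leaderOf` of the sequence number, and only certificates for these canonical leaders lead to
decisions. This matters because a wave starts a view for every party and wedges only the elected
one.

Two sets of n - t parties share at least n - 2t > t members, hence an honest one
(`exists_honest_signer`). An honest party issues one key share per view, so two keys of one view are
for the same value (`Inv.preKeyStep_unique`). An honest share of a later phase presupposes the
signature of the phase before, so a commit certificate implies a key for the same view and value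
(`Inv.preKeyStep_of_lockStep`).

Now take a commit certificate for v in canonical view sq and a key for w in a later canonical view
sq'. A common honest signer sent a commit share in sq and a key share in sq'. It passes through
views in increasing order and a wedged view stays dead, so the commit share came first and the lock
was at least sq when the key share was issued. The key share therefore required a key for w from
some view k with sq ≤ k < sq' (`Signing.recent`). Strong induction on sq' gives v = w
(`Inv.preKeyStep_eq`). For two commit certificates, apply this to the older one and to the key
implied by the newer one.

The rest shows that these facts are invariant along runs (`Inv`): the order of views (`Positioned`),
the backing of every signature in circulation by actual signers (`Justified`, `PState.Holds`), and
the discipline of honest shares (`Signing`). -/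

/-! ### The leader of each sequence number -/

/-- The value of `RRleader` in the `k`-th iteration of the fallback. -/
def Params.roundRobin (P : Params V) : ℕ → ℕ
  | 0 => 1
  | k + 1 => (P.roundRobin k + 1) % P.n

/-- The leader that every honest party eventually records for a sequence number. -/
def Params.leaderOf (P : Params V) (sq : ℕ) : Fin P.n :=
  if sq ≤ P.n then P.p sq
  else if (sq - P.n) % 2 = 0 then P.p (P.hash (.full .low (.coin sq)) % P.n)
  else P.p (P.roundRobin ((sq - P.n - 3) / 2))

theorem leaderOf_sync {j : ℕ} (hj : j ≤ P.n) : P.leaderOf j = P.p j := by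
  simp [Params.leaderOf, hj]

/-- The fallback begins at `n + 2` and alternates waves with round-robin views, so the parity of `sq
- n` tells them apart. The value of `leaderOf` at `n + 1` is irrelevant, since no view has that
number. -/
theorem leaderOf_wave (k : ℕ) : P.leaderOf (P.n + 2 + 2 * k) =
    P.p (P.hash (.full .low (.coin (P.n + 2 + 2 * k))) % P.n) := by
  rw [Params.leaderOf, if_neg (by omega), if_pos (by omega)]

theorem leaderOf_roundRobin (k : ℕ) :
    P.leaderOf (P.n + 2 + 2 * k + 1) = P.p (P.roundRobin k) := by
  rw [Params.leaderOf, if_neg (by omega), if_neg (by omega)]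
  congr 2
  omega

theorem threshold_pos (P : Params V) (c : Scheme) : 0 < P.threshold c := by
  have := P.three_mul_t_lt
  cases c <;> simp only [Params.threshold] <;> omega

/-- Enough shares on the coin of `sq` determine the elected leader. -/
theorem elected_eq {s : PState P.n V} {sq : ℕ}
    (hS : ∀ x ∈ s.Scoin sq, ∃ j, x = .share .low j (.coin sq))
    (hc : P.t + 1 ≤ (s.Scoin sq).ncard) :
    elected P sq s = P.p (P.hash (.full .low (.coin sq)) % P.n) := by
  have himage : s.Scoin sq =
      (fun j => Sig.share .low j (.coin sq)) '' {j | Sig.share .low j (.coin sq) ∈ s.Scoin sq} := by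
    ext x
    constructor
    · intro hx
      obtain ⟨j, rfl⟩ := hS x hx
      exact ⟨j, hx, rfl⟩
    · rintro ⟨j, hj, rfl⟩
      exact hj
  have hex : ∃ m, P.threshold .low ≤ {i | Sig.share .low i m ∈ s.Scoin sq}.ncard := by
    refine ⟨.coin sq, hc.trans ?_⟩
    conv_lhs => rw [himage]
    exact Set.ncard_image_le (Set.toFinite _)
  -- The threshold is positive, so the chosen statement has at least one stored share; all stored
  -- shares are on the coin, which leaves no other statement. The result thus does not depend on
  -- which shares were collected.
  have hchoose : hex.choose = .coin sq := by
    have hpos := (threshold_pos P .low).trans_le hex.choose_spec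
    obtain ⟨i, hi⟩ := (Set.ncard_pos (Set.toFinite _)).1 hpos
    obtain ⟨j, hj⟩ := hS _ hi
    injection hj
  unfold elected thresholdSign
  rw [dif_pos hex, hchoose]

/-! ### Position of the main thread -/

/-- The views of canonical leaders with smaller sequence number are over. -/
def Loc.closed (n : ℕ) : Loc → ℕ
  | .idle => 1
  | .syncTop j => j
  | .keyWait j _ => j
  | .syncView j _ => j
  | .syncHelp => n + 2
  | .waveTop sq _ => sq
  | .barrier sq _ => sq
  | .elect sq _ => sq
  | .waveExchange sq _ => sq + 1
  | .waveHelp sq _ => sq + 1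
  | .rrView sq _ _ => sq + 1
  | .rrExchange sq _ => sq + 2
  | .rrHelp sq _ => sq + 2

/-- The views that were started have smaller sequence number. -/
def Loc.bound (n : ℕ) : Loc → ℕ
  | .syncView j _ => j + 1
  | .barrier sq _ => sq + 1
  | .elect sq _ => sq + 1
  | .rrView sq _ _ => sq + 2
  | l => l.closed n

/-- The sequence number and the round-robin leader belong to the same iteration. -/
def Params.IsRound (P : Params V) (sq rr : ℕ) : Prop :=
  ∃ k, sq = P.n + 2 + 2 * k ∧ rr = P.roundRobin k

/-- The places that the main thread can reach. -/
def Params.Reachable (P : Params V) : Loc → Prop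
  | .idle => True
  | .syncTop j => j ≤ P.n + 1
  | .keyWait j _ => j ≤ P.n
  | .syncView j _ => j ≤ P.n
  | .syncHelp => True
  | .waveTop sq rr => P.IsRound sq rr
  | .barrier sq rr => P.IsRound sq rr
  | .elect sq rr => P.IsRound sq rr
  | .waveExchange sq rr => P.IsRound sq rr
  | .waveHelp sq rr => P.IsRound sq rr
  | .rrView sq rr _ => P.IsRound sq rr
  | .rrExchange sq rr => P.IsRound sq rr
  | .rrHelp sq rr => P.IsRound sq rr

/-- At most one sequence number is open at a time: by `Ordered`, a canonical view that is started
and still active must have sequence number exactly `closed`. -/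
theorem bound_le_closed_succ (n : ℕ) (l : Loc) : l.bound n ≤ l.closed n + 1 := by
  cases l <;> simp [Loc.closed, Loc.bound]

/-- The part of the invariant of an honest party that concerns its views, its leader table and its
lock.  `c` and `b` are the values of `Loc.closed` and `Loc.bound`. -/
structure Ordered (P : Params V) (c b : ℕ) (s : PState P.n V) : Prop where
  coin : ∀ sq, ∀ x ∈ s.Scoin sq, ∃ j, x = .share .low j (.coin sq)
  started_lt : ∀ sq l, (s.lbv sq l).started = true → sq < b
  leader : ∀ sq l, s.LEADER sq = some l → l = P.leaderOf sq ∧ sq < c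
  inactive : ∀ sq, sq < c → (s.lbv sq (P.leaderOf sq)).started = true →
    (s.lbv sq (P.leaderOf sq)).active = false
  lock_lt : ∀ lk, s.LOCK = some lk → lk < c
  lock_ge : ∀ sq, sq < c → (s.lbv sq (P.leaderOf sq)).lockProof ≠ none →
    ∃ lk, s.LOCK = some lk ∧ sq ≤ lk
  lockProof_started : ∀ sq l, (s.lbv sq l).lockProof ≠ none → (s.lbv sq l).started = true

/-- The invariant on the position of the main thread of an honest party. -/
structure Positioned (P : Params V) (s : PState P.n V) : Prop where
  reachable : P.Reachable s.loc
  ordered : Ordered P (s.loc.closed P.n) (s.loc.bound P.n) s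

/-- A change of state that does not concern the main thread. -/
structure Frame (s s' : PState P.n V) : Prop where
  loc : s'.loc = s.loc
  lock : s'.LOCK = s.LOCK
  leader : s'.LEADER = s.LEADER
  started : ∀ sq l, (s'.lbv sq l).started = (s.lbv sq l).started
  active : ∀ sq l, (s'.lbv sq l).active = (s.lbv sq l).active
  lockProof : ∀ sq l, (s'.lbv sq l).lockProof = (s.lbv sq l).lockProof ∨
    ((s.lbv sq l).started = true ∧ (s.lbv sq l).active = true ∧ (s'.lbv sq l).lockProof ≠ none)
  sentKeyShare : ∀ sq l, (s.lbv sq l).sentKeyShare = true → (s'.lbv sq l).sentKeyShare = true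
  coin : ∀ sq, ∀ x ∈ s'.Scoin sq, x ∈ s.Scoin sq ∨ ∃ j, x = .share .low j (.coin sq)

theorem Frame.of_eq {s s' : PState P.n V} (h₁ : s'.loc = s.loc) (h₂ : s'.LOCK = s.LOCK)
    (h₃ : s'.LEADER = s.LEADER) (h₄ : s'.lbv = s.lbv)
    (h₅ : ∀ sq, ∀ x ∈ s'.Scoin sq, x ∈ s.Scoin sq ∨ ∃ j, x = .share .low j (.coin sq)) :
    Frame s s' where
  loc := h₁
  lock := h₂
  leader := h₃
  started _ _ := by rw [h₄]
  active _ _ := by rw [h₄]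
  lockProof _ _ := by rw [h₄]; exact .inl rfl
  sentKeyShare _ _ := by rw [h₄]; exact id
  coin := h₅

theorem Frame.refl {s : PState P.n V} : Frame s s :=
  .of_eq rfl rfl rfl rfl fun _ _ hx => .inl hx

theorem setLBV_lbv {n : ℕ} (s : PState n V) (sq : ℕ) (l : Fin n) (b : LBV n V) (sq' : ℕ)
    (l' : Fin n) : (s.setLBV sq l b).lbv sq' l' = if sq' = sq ∧ l' = l then b else s.lbv sq' l' := by
  by_cases h : sq' = sq
  · subst h
    by_cases h' : l' = l
    · subst h'; simp [PState.setLBV]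
    · simp [PState.setLBV, h']
  · simp [PState.setLBV, h]

theorem Frame.setLBV {s : PState P.n V} {sq : ℕ} {l : Fin P.n} {b : LBV P.n V}
    (h₁ : b.started = (s.lbv sq l).started) (h₂ : b.active = (s.lbv sq l).active)
    (h₃ : b.lockProof = (s.lbv sq l).lockProof ∨
      ((s.lbv sq l).started = true ∧ (s.lbv sq l).active = true ∧ b.lockProof ≠ none))
    (h₄ : (s.lbv sq l).sentKeyShare = true → b.sentKeyShare = true) :
    Frame s (s.setLBV sq l b) where
  loc := rfl
  lock := rfl
  leader := rfl
  started sq' l' := by rw [setLBV_lbv]; grind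
  active sq' l' := by rw [setLBV_lbv]; grind
  lockProof sq' l' := by rw [setLBV_lbv]; grind
  sentKeyShare sq' l' := by rw [setLBV_lbv]; grind
  coin _ _ hx := .inl hx

/-- A frame can set a `lockProof` only in a started, active view, while the started canonical views
below `closed` are inactive. So no handler creates a new lock obligation for a view that is over.
Changes of `KEY`, `VALUE` and `COMMIT` are irrelevant here. -/
theorem Frame.positioned {s s' : PState P.n V} (hf : Frame s s') (h : Positioned P s) :
    Positioned P s' := by
  refine ⟨hf.loc ▸ h.reachable, ?_⟩
  rw [hf.loc]
  have ho := h.ordered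
  refine ⟨?_, ?_, ?_, ?_, ?_, ?_, ?_⟩
  · intro sq x hx
    rcases hf.coin sq x hx with h' | h'
    exacts [ho.coin sq x h', h']
  · intro sq l
    rw [hf.started]
    exact ho.started_lt sq l
  · rw [hf.leader]
    exact ho.leader
  · intro sq
    rw [hf.started, hf.active]
    exact ho.inactive sq
  · rw [hf.lock]
    exact ho.lock_lt
  · intro sq hsq
    rw [hf.lock]
    rcases hf.lockProof sq (P.leaderOf sq) with h' | ⟨h₁, h₂, -⟩
    · rw [h']
      exact ho.lock_ge sq hsq
    · simp [ho.inactive sq hsq h₁] at h₂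
  · intro sq l
    rw [hf.started]
    rcases hf.lockProof sq l with h' | ⟨h₁, -, -⟩
    · rw [h']
      exact ho.lockProof_started sq l
    · exact fun _ => h₁

theorem checkUpdateKey_frame (key : Option (Key P.n V)) (value : Option V) (s : PState P.n V) :
    Frame s (checkUpdateKey key value s) := by
  unfold checkUpdateKey
  split <;> exact .of_eq rfl rfl rfl rfl fun _ _ hx => .inl hx

theorem checkUpdateCommit_frame (cert : Option (Cert P.n V)) (s : PState P.n V) :
    Frame s (checkUpdateCommit cert s) := by
  unfold checkUpdateCommit
  split
  · exact .refl
  · split <;> exact .of_eq rfl rfl rfl rfl fun _ _ hx => .inl hx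

theorem Frame.trans {s s' s'' : PState P.n V} (h : Frame s s') (h' : Frame s' s'') :
    Frame s s'' where
  loc := h'.loc.trans h.loc
  lock := h'.lock.trans h.lock
  leader := h'.leader.trans h.leader
  started _ _ := (h'.started _ _).trans (h.started _ _)
  active _ _ := (h'.active _ _).trans (h.active _ _)
  lockProof sq l := by
    have h₁ := h.lockProof sq l
    have h₂ := h'.lockProof sq l
    rw [h.started, h.active] at h₂
    grind
  sentKeyShare _ _ hs := h'.sentKeyShare _ _ (h.sentKeyShare _ _ hs)
  coin sq x hx := (h'.coin sq x hx).elim (h.coin sq x) .inr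

/-- Handling a message does not move the main thread. -/
theorem receive_frame (i src : Fin P.n) (m : Msg P.n V) (s : PState P.n V) :
    Frame s (receive P i src m s).1 := by
  cases m with
  | exchange sq key value cert =>
    exact ((checkUpdateKey_frame key value s).trans (checkUpdateCommit_frame cert _)).trans
      (.of_eq rfl rfl rfl rfl fun _ _ hx => .inl hx)
  | keyReply key value => exact checkUpdateKey_frame key value s
  | helpReply sq cert => exact checkUpdateCommit_frame cert s
  | coinShare sq ρ =>
    simp only [receive]
    split
    next h =>
      refine .of_eq rfl rfl rfl rfl fun sq' x hx => ?_
      by_cases hsq : sq' = sq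
      · subst hsq
        simp only [Function.update_self] at hx
        rcases hx with rfl | hx
        exacts [.inr ⟨src, h⟩, .inl hx]
      · simp only [Function.update_of_ne hsq] at hx
        exact .inl hx
    next => exact .refl
  | _ =>
    simp only [receive]
    (repeat' split) <;> first
      | exact .refl
      | exact .setLBV rfl rfl (.inl rfl) id
      | exact .of_eq rfl rfl rfl rfl fun _ _ hx => .inl hx
      | refine .setLBV rfl rfl (.inl rfl) fun _ => rfl
      -- This is the `lockStep` handler, the only one that writes `lockProof`; its guard supplies
      -- that the view is started and active.
      | refine .setLBV rfl rfl (.inr ⟨?_, ?_, by simp⟩) id <;> simp_all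

/-! ### Steps of the main thread -/

theorem Ordered.of_eq {c b : ℕ} {s s' : PState P.n V} (h : Ordered P c b s)
    (h₁ : s'.LOCK = s.LOCK) (h₂ : s'.LEADER = s.LEADER) (h₃ : s'.lbv = s.lbv)
    (h₄ : s'.Scoin = s.Scoin) : Ordered P c b s' := by
  obtain ⟨a₁, a₂, a₃, a₄, a₅, a₆, a₇⟩ := h
  refine ⟨?_, ?_, ?_, ?_, ?_, ?_, ?_⟩ <;> simpa only [h₁, h₂, h₃, h₄]

/-- Sequence numbers may be passed over without a view. -/
theorem Ordered.skip {c c' : ℕ} {s : PState P.n V} (h : Ordered P c c s) (hc : c ≤ c') :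
    Ordered P c' c' s where
  coin := h.coin
  started_lt sq l hs := (h.started_lt sq l hs).trans_le hc
  leader sq l hl := ⟨(h.leader sq l hl).1, (h.leader sq l hl).2.trans_le hc⟩
  inactive sq _ hs := h.inactive sq (h.started_lt sq _ hs) hs
  lock_lt lk hlk := (h.lock_lt lk hlk).trans_le hc
  lock_ge sq _ hp := h.lock_ge sq (h.started_lt sq _ (h.lockProof_started sq _ hp)) hp
  lockProof_started := h.lockProof_started

theorem startViews_started {i : Fin P.n} {sq : ℕ} {L : Set (Fin P.n)} {s : PState P.n V}
    {sq' : ℕ} {l : Fin P.n} (h : ((startViews i sq L s).lbv sq' l).started = true) :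
    sq' = sq ∨ (s.lbv sq' l).started = true := by
  by_cases hsq : sq' = sq
  · exact .inl hsq
  · exact .inr (by simpa [startViews, hsq] using h)

theorem started_startViews {i : Fin P.n} {sq : ℕ} {L : Set (Fin P.n)} {s : PState P.n V}
    {sq' : ℕ} {l : Fin P.n} (h : (s.lbv sq' l).started = true) :
    ((startViews i sq L s).lbv sq' l).started = true := by
  by_cases hsq : sq' = sq
  · subst hsq
    simp only [startViews, Function.update_self]
    split <;> simp [h]
  · simpa [startViews, hsq] using h

theorem startViews_fields (i : Fin P.n) (sq : ℕ) (L : Set (Fin P.n)) (s : PState P.n V)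
    (sq' : ℕ) (l : Fin P.n) :
    ((startViews i sq L s).lbv sq' l).active = (s.lbv sq' l).active ∧
    ((startViews i sq L s).lbv sq' l).lockProof = (s.lbv sq' l).lockProof ∧
    ((startViews i sq L s).lbv sq' l).sentKeyShare = (s.lbv sq' l).sentKeyShare := by
  by_cases hsq : sq' = sq
  · subst hsq
    simp only [startViews, Function.update_self]
    split <;> simp
  · simp [startViews, hsq]

/-- The new views have number `c`, so nothing changes below `c`. The set of leaders is arbitrary in
order to cover waves as well. -/
theorem Ordered.start {c b : ℕ} {s : PState P.n V} (h : Ordered P c b s) (hb : b ≤ c + 1)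
    (i : Fin P.n) (L : Set (Fin P.n)) : Ordered P c (c + 1) (startViews i c L s) where
  coin := h.coin
  started_lt sq l hs := by
    rcases startViews_started hs with rfl | hs
    · exact Nat.lt_succ_self _
    · exact (h.started_lt sq l hs).trans_le hb
  leader := h.leader
  inactive sq hsq hs := by
    rw [(startViews_fields i c L s _ _).1]
    rcases startViews_started hs with rfl | hs
    · exact absurd hsq (lt_irrefl _)
    · exact h.inactive sq hsq hs
  lock_lt := h.lock_lt
  lock_ge sq hsq hp := by
    rw [(startViews_fields i c L s _ _).2.1] at hp
    exact h.lock_ge sq hsq hp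
  lockProof_started sq l hp := by
    rw [(startViews_fields i c L s _ _).2.1] at hp
    exact started_startViews (h.lockProof_started sq l hp)

theorem wedgeAndUpdate_lbv (c : ℕ) (l : Fin P.n) (s : PState P.n V) (sq : ℕ) (l' : Fin P.n) :
    (wedgeAndUpdate c l s).lbv sq l' =
      if sq = c ∧ l' = l then { s.lbv c l with active := false } else s.lbv sq l' :=
  setLBV_lbv s c l _ sq l'

theorem wedgeAndUpdate_fields (c : ℕ) (l : Fin P.n) (s : PState P.n V) (sq : ℕ) (l' : Fin P.n) :
    ((wedgeAndUpdate c l s).lbv sq l').started = (s.lbv sq l').started ∧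
    ((wedgeAndUpdate c l s).lbv sq l').lockProof = (s.lbv sq l').lockProof ∧
    ((wedgeAndUpdate c l s).lbv sq l').sentKeyShare = (s.lbv sq l').sentKeyShare := by
  rw [wedgeAndUpdate_lbv]
  split
  next h => obtain ⟨rfl, rfl⟩ := h; simp
  next => simp

/-- `LOCK` only ever grows: all earlier locks are below `c`, and the only possible new value is `c`.
Only the view of `l` becomes inactive, which is why `l` has to be the canonical leader; the other
views of a wave stay active, and nothing is claimed about them. -/
theorem Ordered.wedge {c : ℕ} {s : PState P.n V} (h : Ordered P c (c + 1) s) {l : Fin P.n}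
    (hl : l = P.leaderOf c) : Ordered P (c + 1) (c + 1) (wedgeAndUpdate c l s) where
  coin := h.coin
  started_lt sq l' hs := by
    rw [(wedgeAndUpdate_fields c l s _ _).1] at hs
    exact h.started_lt sq l' hs
  leader sq l' hl' := by
    by_cases hsq : sq = c
    · subst hsq
      have : l = l' := by simpa [wedgeAndUpdate, updateState] using hl'
      exact ⟨this ▸ hl, Nat.lt_succ_self _⟩
    · have : s.LEADER sq = some l' := by
        simpa [wedgeAndUpdate, updateState, PState.setLBV, hsq] using hl'
      exact ⟨(h.leader sq l' this).1, Nat.lt_succ_of_lt (h.leader sq l' this).2⟩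
  inactive sq hsq hs := by
    rw [(wedgeAndUpdate_fields c l s _ _).1] at hs
    rw [wedgeAndUpdate_lbv]
    split
    next => rfl
    next hne =>
      refine h.inactive sq (lt_of_le_of_ne (Nat.lt_succ_iff.1 hsq) ?_) hs
      rintro rfl
      exact hne ⟨rfl, hl.symm⟩
  lock_lt lk hlk := by
    cases hp : (s.lbv c l).lockProof with
    | none => exact Nat.lt_succ_of_lt (h.lock_lt lk (by
        simpa [wedgeAndUpdate, updateState, PState.setLBV, hp] using hlk))
    | some p =>
      have : c = lk := by simpa [wedgeAndUpdate, updateState, hp] using hlk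
      omega
  lock_ge sq hsq hq := by
    rw [(wedgeAndUpdate_fields c l s _ _).2.1] at hq
    cases hp : (s.lbv c l).lockProof with
    | some p => exact ⟨c, by simp [wedgeAndUpdate, updateState, hp], Nat.lt_succ_iff.1 hsq⟩
    | none =>
      -- The canonical view of `c` left no `lockProof`, so the obligation comes from an older view
      -- and the unchanged lock already meets it.
      have hne : sq ≠ c := by
        rintro rfl
        exact hq (hl ▸ hp)
      obtain ⟨lk, h₁, h₂⟩ := h.lock_ge sq (by omega) hq
      exact ⟨lk, by simpa [wedgeAndUpdate, updateState, PState.setLBV, hp] using h₁, h₂⟩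
  lockProof_started sq l' hq := by
    rw [(wedgeAndUpdate_fields c l s _ _).2.1] at hq
    rw [(wedgeAndUpdate_fields c l s _ _).1]
    exact h.lockProof_started sq l' hq

theorem positioned_init (P : Params V) : Positioned P (PState.init P.n V) where
  reachable := trivial
  ordered := by
    constructor <;> simp [PState.init, LBV.init]

/-- Steps of the threads preserve the position invariant. -/
theorem ThreadStep.positioned {i : Fin P.n} {now : ℝ} {s s' : PState P.n V}
    {out : Outbox P.n V} (hstep : ThreadStep P i now s s' out) (hs : Positioned P s) :
    Positioned P s' := by
  obtain ⟨hr, ho⟩ := hs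
  cases hstep with
  | propose v h =>
    rw [h] at ho
    exact ⟨by simp [Params.Reachable], ho.of_eq rfl rfl rfl rfl⟩
  | syncStart j h hj hi =>
    rw [h] at ho
    exact ⟨hj, (ho.start (Nat.le_succ _) i {P.p j}).of_eq rfl rfl rfl rfl⟩
  | keyRequest j h hj hi hc =>
    rw [h] at ho
    exact ⟨hj, ho.of_eq rfl rfl rfl rfl⟩
  | syncSkip j h hj hi hc =>
    rw [h] at ho
    exact ⟨Nat.succ_le_succ hj, (ho.skip (Nat.le_succ _)).of_eq rfl rfl rfl rfl⟩
  | keyWaitEnd j d h hd =>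
    rw [h] at ho hr
    exact ⟨hr, (ho.start (Nat.le_succ _) i {P.p j}).of_eq rfl rfl rfl rfl⟩
  | syncWedge j d h hd =>
    rw [h] at ho hr
    exact ⟨Nat.succ_le_succ hr, (ho.wedge (leaderOf_sync hr).symm).of_eq rfl rfl rfl rfl⟩
  | syncEnd h =>
    rw [h] at ho
    -- The number `n + 1` is used for `help&tryHalting` only, so it is passed over without a view.
    exact ⟨trivial, (ho.skip (Nat.le_succ _)).of_eq rfl rfl rfl rfl⟩
  | syncHelpEnd h hh =>
    rw [h] at ho
    exact ⟨⟨0, rfl, rfl⟩, ho.of_eq rfl rfl rfl rfl⟩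
  | waveStart sq rr h =>
    rw [h] at ho hr
    exact ⟨hr, (ho.start (Nat.le_succ _) i Set.univ).of_eq rfl rfl rfl rfl⟩
  | barrierEnd sq rr h hready =>
    rw [h] at ho hr
    exact ⟨hr, ho.of_eq rfl rfl rfl rfl⟩
  | electEnd _ sq rr h hc hs =>
    rw [h] at ho hr
    subst hs
    obtain ⟨k, rfl, rfl⟩ := hr
    have hl := (elected_eq (ho.coin _) hc).trans (leaderOf_wave k).symm
    exact ⟨⟨k, rfl, rfl⟩, (ho.wedge hl).of_eq rfl rfl rfl rfl⟩
  | waveExchangeEnd sq rr h he =>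
    rw [h] at ho hr
    exact ⟨hr, ho.of_eq rfl rfl rfl rfl⟩
  | rrStart sq rr h hh =>
    rw [h] at ho hr
    exact ⟨hr, (ho.start (Nat.le_succ _) i {P.p rr}).of_eq rfl rfl rfl rfl⟩
  | rrWedge _ sq rr d h hd hs =>
    rw [h] at ho hr
    subst hs
    obtain ⟨k, rfl, rfl⟩ := hr
    exact ⟨⟨k, rfl, rfl⟩, (ho.wedge (leaderOf_roundRobin k).symm).of_eq rfl rfl rfl rfl⟩
  | rrExchangeEnd sq rr h he =>
    rw [h] at ho hr
    exact ⟨hr, ho.of_eq rfl rfl rfl rfl⟩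
  | rrHelpEnd sq rr h hh =>
    rw [h] at ho hr
    obtain ⟨k, rfl, rfl⟩ := hr
    exact ⟨⟨k + 1, by ring, rfl⟩, ho.of_eq rfl rfl rfl rfl⟩
  | leaderKeyStep sq v h hS hv => exact (Frame.setLBV (by rfl) (by rfl) (.inl (by rfl)) (by exact id)).positioned ⟨hr, ho⟩
  | leaderLockStep sq v h hS hv => exact (Frame.setLBV (by rfl) (by rfl) (.inl (by rfl)) (by exact id)).positioned ⟨hr, ho⟩
  | leaderCommit sq v h hS hv => exact (Frame.setLBV (by rfl) (by rfl) (.inl (by rfl)) (by exact id)).positioned ⟨hr, ho⟩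
  | viewReturns sq l h hd hr' hl => exact (Frame.setLBV (by rfl) (by rfl) (.inl (by rfl)) (by exact id)).positioned ⟨hr, ho⟩
  | barrierReady sq h => exact ⟨hr, ho⟩

/-- What a party did in its views is never forgotten. -/
structure Grows (s s' : PState P.n V) : Prop where
  started : ∀ sq l, (s.lbv sq l).started = true → (s'.lbv sq l).started = true
  sentKeyShare : ∀ sq l, (s.lbv sq l).sentKeyShare = true → (s'.lbv sq l).sentKeyShare = true
  lockProof : ∀ sq l, (s.lbv sq l).lockProof ≠ none → (s'.lbv sq l).lockProof ≠ none

theorem Frame.grows {s s' : PState P.n V} (h : Frame s s') : Grows s s' where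
  started sq l hs := by rwa [h.started]
  sentKeyShare := h.sentKeyShare
  lockProof sq l hp := by
    rcases h.lockProof sq l with h' | ⟨-, -, h'⟩
    · rwa [h']
    · exact h'

theorem Grows.of_eq {s s' : PState P.n V} (h : s'.lbv = s.lbv) : Grows s s' := by
  constructor <;> simp [h]

theorem grows_startViews (i : Fin P.n) (sq : ℕ) (L : Set (Fin P.n)) (s : PState P.n V) :
    Grows s (startViews i sq L s) where
  started _ _ := started_startViews
  sentKeyShare sq' l hs := by rwa [(startViews_fields i sq L s sq' l).2.2]
  lockProof sq' l hp := by rwa [(startViews_fields i sq L s sq' l).2.1]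

theorem grows_wedgeAndUpdate (sq : ℕ) (l : Fin P.n) (s : PState P.n V) :
    Grows s (wedgeAndUpdate sq l s) where
  started sq' l' hs := by rwa [(wedgeAndUpdate_fields sq l s sq' l').1]
  sentKeyShare sq' l' hs := by rwa [(wedgeAndUpdate_fields sq l s sq' l').2.2]
  lockProof sq' l' hp := by rwa [(wedgeAndUpdate_fields sq l s sq' l').2.1]

theorem Grows.congr_right {s s' s'' : PState P.n V} (h : Grows s s') (he : s''.lbv = s'.lbv) :
    Grows s s'' := by
  obtain ⟨h₁, h₂, h₃⟩ := h
  constructor <;> rwa [he]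

theorem ThreadStep.grows {i : Fin P.n} {now : ℝ} {s s' : PState P.n V} {out : Outbox P.n V}
    (hstep : ThreadStep P i now s s' out) : Grows s s' := by
  cases hstep
  all_goals try subst_vars
  all_goals first
    | exact .of_eq rfl
    | exact (grows_startViews _ _ _ _).congr_right rfl
    | exact (grows_wedgeAndUpdate _ _ _).congr_right rfl
    | exact (Frame.setLBV (by rfl) (by rfl) (.inl (by rfl)) (by exact id)).grows

/-! ### Justified signatures -/

/-- Party `i` sent its share on a step statement; nothing is recorded for other statements. -/
def Signed {n : ℕ} (sent : Set (Envelope n V)) (i : Fin n) : Stmt n V → Prop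
  | .preKeyStep sq l v =>
    ∃ dst, (i, dst, .keyShare sq l (.share .high i (.preKeyStep sq l v))) ∈ sent
  | .keyStep sq l v => ∃ dst, (i, dst, .lockShare sq l (.share .high i (.keyStep sq l v))) ∈ sent
  | .lockStep sq l v =>
    ∃ dst, (i, dst, .commitShare sq l (.share .high i (.lockStep sq l v))) ∈ sent
  | .helpRequest _ => True
  | .shareReady _ => True
  | .coin _ => True

/-- The signature string is backed by enough signers. -/
def Justified (P : Params V) (byz : Finset (Fin P.n)) (sent : Set (Envelope P.n V)) :
    Sig P.n V → Prop
  | .share _ i m => i ∈ byz ∨ Signed sent i m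
  | .full c m => ∃ Q : Finset (Fin P.n), P.threshold c ≤ Q.card ∧ ∀ i ∈ Q, i ∈ byz ∨ Signed sent i m
  | .junk _ => True

theorem Signed.mono {n : ℕ} {sent sent' : Set (Envelope n V)} (hsub : sent ⊆ sent') {i : Fin n}
    {m : Stmt n V} (h : Signed sent i m) : Signed sent' i m := by
  cases m with
  | preKeyStep sq l v => exact h.imp fun _ hd => hsub hd
  | keyStep sq l v => exact h.imp fun _ hd => hsub hd
  | lockStep sq l v => exact h.imp fun _ hd => hsub hd
  | _ => trivial

theorem Justified.mono {byz : Finset (Fin P.n)} {sent sent' : Set (Envelope P.n V)}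
    (hsub : sent ⊆ sent') {x : Sig P.n V} (h : Justified P byz sent x) :
    Justified P byz sent' x := by
  cases x with
  | share c i m => exact h.imp_right (Signed.mono hsub)
  | full c m =>
    obtain ⟨Q, hQ, hi⟩ := h
    exact ⟨Q, hQ, fun i hiQ => (hi i hiQ).imp_right (Signed.mono hsub)⟩
  | junk w => trivial

theorem justified_thresholdSign {byz : Finset (Fin P.n)} {sent : Set (Envelope P.n V)}
    (c : Scheme) {S : Set (Sig P.n V)} (hS : ∀ x ∈ S, Justified P byz sent x) :
    Justified P byz sent (thresholdSign P c S) := by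
  unfold thresholdSign
  split
  next h =>
    have hfin := Set.toFinite {i | Sig.share c i h.choose ∈ S}
    refine ⟨hfin.toFinset, ?_, fun i hi => hS (.share c i h.choose) (hfin.mem_toFinset.1 hi)⟩
    rw [← Set.ncard_eq_toFinset_card _ hfin]
    exact h.choose_spec
  next => trivial

/-- Perfection of signatures enters here: whatever the adversary can assemble from justified
messages is again backed by byzantine parties or actual signers. -/
theorem Available.justified {byz : Finset (Fin P.n)} {sent : Set (Envelope P.n V)}
    (hsent : ∀ e ∈ sent, ∀ x ∈ e.2.2.sigs, Justified P byz sent x) {x : Sig P.n V}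
    (h : Available P byz sent x) : Justified P byz sent x := by
  induction h with
  | seen e he x hx => exact hsent e he x hx
  | own c i hi m => exact .inl hi
  | combine c m Q hQ _ ih => exact ⟨Q, hQ, ih⟩
  | junk w => trivial

/-! ### Signatures held by a party -/

/-- The signatures stored in the record of a view satisfy `Φ`. -/
structure LBV.Holds (Φ : Sig P.n V → Prop) (sq : ℕ) (l : Fin P.n) (b : LBV P.n V) : Prop where
  keyProof : ∀ p ∈ b.keyProof, Φ p.2
  commitProof : ∀ p ∈ b.commitProof, Φ p.2 ∧ p.2 = .full .high (.lockStep sq l p.1)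
  key : ∀ x ∈ b.Skey, Φ x
  lock : ∀ x ∈ b.Slock, Φ x
  commit : ∀ x ∈ b.Scommit, Φ x

/-- The signatures stored by a party satisfy `Φ`, and its decisions come with certificates that
satisfy `Φ`. -/
structure PState.Holds (Φ : Sig P.n V → Prop) (s : PState P.n V) : Prop where
  key : ∀ k ∈ s.KEY, Φ k.2
  cert : ∀ c ∈ s.COMMIT, Φ c.2.2
  lbv : ∀ sq l, (s.lbv sq l).Holds Φ sq l
  barrier : ∀ sq, ∀ x ∈ s.Sbarrier sq, Φ x
  help : ∀ sq, ∀ x ∈ s.Shelp sq, Φ x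
  decided : ∀ v ∈ s.decisions, ∃ sq, Φ (.full .high (.lockStep sq (P.leaderOf sq) v))

theorem LBV.Holds.mono {Φ Ψ : Sig P.n V → Prop} (hΦ : ∀ x, Φ x → Ψ x) {sq : ℕ} {l : Fin P.n}
    {b : LBV P.n V} (h : b.Holds Φ sq l) : b.Holds Ψ sq l where
  keyProof p hp := hΦ _ (h.keyProof p hp)
  commitProof p hp := (h.commitProof p hp).imp_left (hΦ _)
  key x hx := hΦ _ (h.key x hx)
  lock x hx := hΦ _ (h.lock x hx)
  commit x hx := hΦ _ (h.commit x hx)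

theorem PState.Holds.mono {Φ Ψ : Sig P.n V → Prop} (hΦ : ∀ x, Φ x → Ψ x) {s : PState P.n V}
    (h : s.Holds Φ) : s.Holds Ψ where
  key k hk := hΦ _ (h.key k hk)
  cert c hc := hΦ _ (h.cert c hc)
  lbv sq l := (h.lbv sq l).mono hΦ
  barrier sq x hx := hΦ _ (h.barrier sq x hx)
  help sq x hx := hΦ _ (h.help sq x hx)
  decided v hv := (h.decided v hv).imp fun _ => hΦ _

theorem holds_init (Φ : Sig P.n V → Prop) : (PState.init P.n V).Holds Φ := by
  constructor <;> try simp [PState.init]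
  intro sq l
  constructor <;> simp [LBV.init]

section Holds

variable {Φ : Sig P.n V → Prop} {s : PState P.n V}

theorem PState.Holds.setLBV (h : s.Holds Φ) {sq : ℕ} {l : Fin P.n} {b : LBV P.n V}
    (hb : b.Holds Φ sq l) : (s.setLBV sq l b).Holds Φ where
  key := h.key
  cert := h.cert
  lbv sq' l' := by
    rw [setLBV_lbv]
    split
    next he => obtain ⟨rfl, rfl⟩ := he; exact hb
    next => exact h.lbv sq' l'
  barrier := h.barrier
  help := h.help
  decided := h.decided

theorem PState.Holds.checkUpdateKey (h : s.Holds Φ) {key : Option (Key P.n V)} {value : Option V}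
    (hkey : ∀ k ∈ key, Φ k.2) : (checkUpdateKey key value s).Holds Φ := by
  unfold OptimisticBA.checkUpdateKey
  split
  · exact { h with key := hkey }
  · exact h

/-- An accepted certificate is checked against the local `LEADER` table, which contains canonical
leaders only; this puts the new decision in the form required by `decided`. -/
theorem PState.Holds.checkUpdateCommit (h : s.Holds Φ)
    (hl : ∀ sq l, s.LEADER sq = some l → l = P.leaderOf sq) {cert : Option (Cert P.n V)}
    (hcert : ∀ c ∈ cert, Φ c.2.2) : (checkUpdateCommit cert s).Holds Φ := by
  unfold OptimisticBA.checkUpdateCommit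
  split
  · exact h
  next c =>
    split
    next hc =>
      refine { h with cert := hcert, decided := fun v hv => ?_ }
      rcases hv with rfl | hv
      · obtain ⟨-, l, hl', hν⟩ := hc
        refine ⟨c.2.1, ?_⟩
        rw [← hl _ _ hl', ← (show c.2.2 = _ from hν)]
        exact hcert c rfl
      · exact h.decided v hv
    next => exact h

theorem PState.Holds.startViews (h : s.Holds Φ) (i : Fin P.n) (sq : ℕ) (L : Set (Fin P.n)) :
    (startViews i sq L s).Holds Φ := by
  refine { h with lbv := fun sq' l => ?_ }
  have hb := h.lbv sq' l
  by_cases hsq : sq' = sq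
  · subst hsq
    simp only [OptimisticBA.startViews, Function.update_self]
    split
    · exact { hb with }
    · exact hb
  · simpa [OptimisticBA.startViews, hsq] using hb

theorem PState.Holds.wedgeAndUpdate (h : s.Holds Φ) {sq : ℕ} {l : Fin P.n}
    (hl : l = P.leaderOf sq) : (wedgeAndUpdate sq l s).Holds Φ := by
  have hb := h.lbv sq l
  have hs := h.setLBV (sq := sq) (l := l) (b := { s.lbv sq l with active := false }) { hb with }
  refine { hs with key := ?_, cert := ?_, decided := ?_ }
  · cases hk : (s.lbv sq l).keyProof with
    | none => simpa [OptimisticBA.wedgeAndUpdate, updateState, hk] using hs.key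
    | some p => simpa [OptimisticBA.wedgeAndUpdate, updateState, hk] using hb.keyProof p hk
  · cases hc : (s.lbv sq l).commitProof with
    | none => simpa [OptimisticBA.wedgeAndUpdate, updateState, hc] using hs.cert
    | some p =>
      simpa [OptimisticBA.wedgeAndUpdate, updateState, hc] using (hb.commitProof p hc).1
  · intro v hv
    cases hc : (s.lbv sq l).commitProof with
    | none =>
      refine hs.decided v ?_
      simpa [OptimisticBA.wedgeAndUpdate, updateState, hc] using hv
    | some p =>
      obtain ⟨h₁, h₂⟩ := hb.commitProof p hc
      have hv' : v = p.1 ∨ v ∈ s.decisions := by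
        simpa [OptimisticBA.wedgeAndUpdate, updateState, hc, PState.setLBV] using hv
      rcases hv' with rfl | hv'
      · exact ⟨sq, by rwa [← hl, ← h₂]⟩
      · exact h.decided v hv'

theorem forall_mem_update_insert {α : Type*} {Φ : α → Prop} {S : ℕ → Set α} {sq : ℕ} {ρ : α}
    (hS : ∀ sq, ∀ x ∈ S sq, Φ x) (hρ : Φ ρ) (sq' : ℕ) :
    ∀ x ∈ Function.update S sq (insert ρ (S sq)) sq', Φ x := by
  intro x hx
  by_cases hsq : sq' = sq
  · subst hsq
    rw [Function.update_self] at hx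
    rcases hx with rfl | hx
    exacts [hρ, hS _ x hx]
  · rw [Function.update_of_ne hsq] at hx
    exact hS _ x hx

/-- Nothing about `Φ` is needed, because a handler stores only signature strings that occur in the
message or were already held. Combined signatures are sent but not stored. -/
theorem receive_holds (i src : Fin P.n) (m : Msg P.n V) (h : s.Holds Φ)
    (hl : ∀ sq l, s.LEADER sq = some l → l = P.leaderOf sq) (hm : ∀ x ∈ m.sigs, Φ x) :
    (receive P i src m s).1.Holds Φ := by
  cases m with
  | exchange sq key value cert =>
    have hk := h.checkUpdateKey (key := key) (value := value)
      fun k hk => hm _ (.inl ⟨k, hk, rfl⟩)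
    have hc := hk.checkUpdateCommit (cert := cert)
      (by rw [(checkUpdateKey_frame key value s).leader]; exact hl)
      fun c hc => hm _ (.inr ⟨c, hc, rfl⟩)
    exact { hc with }
  | keyReply key value => exact h.checkUpdateKey fun k hk => hm _ ⟨k, hk, rfl⟩
  | helpReply sq cert => exact h.checkUpdateCommit hl fun c hc => hm _ ⟨c, hc, rfl⟩
  | preKeyStep sq l v key =>
    simp only [receive]
    split
    · exact h.setLBV { h.lbv sq l with }
    · exact h
  | keyShare sq l ρ =>
    simp only [receive]
    have hb := h.lbv sq l
    split
    · split
      · exact h.setLBV { hb with key := Set.forall_mem_insert.2 ⟨hm ρ rfl, hb.key⟩ }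
      · exact h.setLBV { hb with }
    · exact h
  | lockShare sq l ρ =>
    simp only [receive]
    have hb := h.lbv sq l
    split
    · split
      · exact h.setLBV { hb with lock := Set.forall_mem_insert.2 ⟨hm ρ rfl, hb.lock⟩ }
      · exact h.setLBV { hb with }
    · exact h
  | commitShare sq l ρ =>
    simp only [receive]
    have hb := h.lbv sq l
    split
    · split
      · exact h.setLBV { hb with commit := Set.forall_mem_insert.2 ⟨hm ρ rfl, hb.commit⟩ }
      · exact h.setLBV { hb with }
    · exact h
  | keyStep sq l v ν =>
    simp only [receive]
    split
    · refine h.setLBV { h.lbv sq l with keyProof := ?_ }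
      rintro _ ⟨⟩
      exact hm ν rfl
    · exact h
  | lockStep sq l v ν =>
    simp only [receive]
    split
    · exact h.setLBV { h.lbv sq l with }
    · exact h
  | commit sq l v ν =>
    simp only [receive]
    split
    next hc =>
      refine h.setLBV { h.lbv sq l with commitProof := ?_ }
      rintro _ ⟨⟩
      exact ⟨hm ν rfl, hc.2.2.2⟩
    next => exact h
  | keyRequest =>
    simp only [receive]
    split
    · exact { h with }
    · exact h
  | yourViewDone sq => exact { h with }
  | helpRequest sq ρ =>
    simp only [receive]
    split
    · exact { h with help := forall_mem_update_insert h.help (hm ρ rfl) }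
    · exact h
  | complain sq ν =>
    simp only [receive]
    split
    · exact { h with }
    · exact h
  | shareReady sq ρ =>
    simp only [receive]
    split
    · exact { h with barrier := forall_mem_update_insert h.barrier (hm ρ rfl) }
    · exact h
  | barrierReady sq ν =>
    simp only [receive]
    split
    · exact { h with }
    · exact h
  | coinShare sq ρ =>
    simp only [receive]
    split
    · exact { h with }
    · exact h

theorem ThreadStep.holds {i : Fin P.n} {now : ℝ} {s' : PState P.n V} {out : Outbox P.n V}
    (hstep : ThreadStep P i now s s' out) (hs : Positioned P s) (h : s.Holds Φ) : s'.Holds Φ := by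
  obtain ⟨hr, ho⟩ := hs
  cases hstep with
  | syncStart j _ _ _ => exact { h.startViews i j {P.p j} with }
  | keyWaitEnd j _ _ _ => exact { h.startViews i j {P.p j} with }
  | waveStart sq _ _ => exact { h.startViews i sq Set.univ with }
  | rrStart sq rr _ _ => exact { h.startViews i (sq + 1) {P.p rr} with }
  | syncWedge j d hloc _ =>
    rw [hloc] at hr
    exact { h.wedgeAndUpdate (leaderOf_sync hr).symm with }
  | electEnd _ sq rr hloc hc hs =>
    rw [hloc] at hr
    subst hs
    obtain ⟨k, rfl, rfl⟩ := hr
    exact { h.wedgeAndUpdate ((elected_eq (ho.coin _) hc).trans (leaderOf_wave k).symm) with }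
  | rrWedge _ sq rr d hloc hd hs =>
    rw [hloc] at hr
    subst hs
    obtain ⟨k, rfl, rfl⟩ := hr
    exact { h.wedgeAndUpdate (leaderOf_roundRobin k).symm with }
  | leaderKeyStep sq _ _ _ _ => exact h.setLBV { h.lbv sq i with }
  | leaderLockStep sq _ _ _ _ => exact h.setLBV { h.lbv sq i with }
  | leaderCommit sq _ _ _ _ => exact h.setLBV { h.lbv sq i with }
  | viewReturns sq l _ _ _ _ => exact h.setLBV { h.lbv sq l with }
  | _ => exact { h with }

end Holds

/-! ### Signatures in outgoing messages -/

section Out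

variable {byz : Finset (Fin P.n)} {sent : Set (Envelope P.n V)} {s : PState P.n V}

/-- The outgoing messages are assumed to be in `sent` already, because a fresh share of `i` is
justified by the very message that carries it. -/
theorem receive_out_justified {i src : Fin P.n} {m : Msg P.n V}
    (h : s.Holds (Justified P byz sent)) (hm : ∀ x ∈ m.sigs, Justified P byz sent x)
    (hout : ∀ e ∈ (receive P i src m s).2, (i, e) ∈ sent) :
    ∀ e ∈ (receive P i src m s).2, ∀ x ∈ e.2.sigs, Justified P byz sent x := by
  intro e he x hx
  have he' := hout e he
  cases m with
  | preKeyStep sq l v key =>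
    simp only [receive] at he
    split at he
    · cases he; cases hx
      exact .inr ⟨_, he'⟩
    · cases he
  | keyStep sq l v ν =>
    simp only [receive] at he
    split at he
    · cases he; cases hx
      exact .inr ⟨_, he'⟩
    · cases he
  | lockStep sq l v ν =>
    simp only [receive] at he
    split at he
    · cases he; cases hx
      exact .inr ⟨_, he'⟩
    · cases he
  | keyRequest =>
    simp only [receive] at he
    split at he
    · cases he
      obtain ⟨k, hk, rfl⟩ := hx
      exact h.key k hk
    · cases he
  | helpRequest sq ρ =>
    simp only [receive] at he
    split at he
    · rcases he with he | he
      · cases he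
        obtain ⟨c, hc, rfl⟩ := hx
        exact h.cert c hc
      · split at he
        · rw [show e.2 = _ from he] at hx
          cases hx
          exact justified_thresholdSign _ (Set.forall_mem_insert.2 ⟨hm ρ rfl, h.help sq⟩)
        · cases he
    · cases he
  | complain sq ν =>
    simp only [receive] at he
    split at he
    · rw [show e.2 = _ from he] at hx
      exact hm x hx
    · cases he
  | shareReady sq ρ =>
    simp only [receive] at he
    split at he
    · split at he
      · rw [show e.2 = _ from he] at hx
        cases hx
        exact justified_thresholdSign _ (Set.forall_mem_insert.2 ⟨hm ρ rfl, h.barrier sq⟩)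
      · cases he
    · cases he
  | barrierReady sq ν =>
    simp only [receive] at he
    split at he
    · rw [show e.2 = _ from he] at hx
      exact hm x hx
    · cases he
  | _ =>
    simp only [receive] at he
    (repeat' split at he) <;> cases he

theorem startOut_justified (h : s.Holds (Justified P byz sent)) {i : Fin P.n} {sq : ℕ}
    {L : Set (Fin P.n)} :
    ∀ e ∈ startOut i sq L s, ∀ x ∈ e.2.sigs, Justified P byz sent x := by
  rintro ⟨dst, m⟩ ⟨-, v, -, rfl⟩ x ⟨k, hk, rfl⟩
  exact h.key k hk

theorem exchangeOut_justified (h : s.Holds (Justified P byz sent)) {sq : ℕ} :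
    ∀ e ∈ exchangeOut sq s, ∀ x ∈ e.2.sigs, Justified P byz sent x := by
  rintro ⟨dst, m⟩ ⟨⟩ x (⟨k, hk, rfl⟩ | ⟨c, hc, rfl⟩)
  exacts [h.key k hk, h.cert c hc]

/-- Both states are needed: after a wedge, `exchangeState` sends the key and the certificate of the
updated state. -/
theorem ThreadStep.out_justified {i : Fin P.n} {now : ℝ} {s' : PState P.n V}
    {out : Outbox P.n V} (hstep : ThreadStep P i now s s' out)
    (h : s.Holds (Justified P byz sent)) (h' : s'.Holds (Justified P byz sent)) :
    ∀ e ∈ out, ∀ x ∈ e.2.sigs, Justified P byz sent x := by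
  have hhelp : ∀ sq, ∀ e ∈ helpOut i sq s, ∀ x ∈ e.2.sigs, Justified P byz sent x := by
    rintro sq ⟨dst, m⟩ ⟨-, rfl⟩ x ⟨⟩
    exact .inr trivial
  cases hstep with
  | syncStart => exact startOut_justified h
  | keyWaitEnd => exact startOut_justified h
  | waveStart => exact startOut_justified h
  | rrStart => exact startOut_justified h
  | electEnd => exact exchangeOut_justified h'
  | rrWedge => exact exchangeOut_justified h'
  | syncEnd => exact hhelp _
  | waveExchangeEnd => exact hhelp _
  | rrExchangeEnd => exact hhelp _
  | keyRequest => rintro ⟨dst, m⟩ ⟨⟩ x ⟨⟩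
  | viewReturns => rintro ⟨dst, m⟩ ⟨⟩ x ⟨⟩
  | barrierEnd =>
    rintro ⟨dst, m⟩ ⟨⟩ x ⟨⟩
    exact .inr trivial
  | barrierReady =>
    rintro ⟨dst, m⟩ ⟨⟩ x ⟨⟩
    exact .inr trivial
  | leaderKeyStep sq =>
    rintro ⟨dst, m⟩ ⟨⟩ x ⟨⟩
    exact justified_thresholdSign _ (h.lbv sq i).key
  | leaderLockStep sq =>
    rintro ⟨dst, m⟩ ⟨⟩ x ⟨⟩
    exact justified_thresholdSign _ (h.lbv sq i).lock
  | leaderCommit sq =>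
    rintro ⟨dst, m⟩ ⟨⟩ x ⟨⟩
    exact justified_thresholdSign _ (h.lbv sq i).commit
  | _ => rintro e ⟨⟩

end Out

/-! ### Shares issued by an honest party -/

/-- Handling `m` from `src` in state `s`, a party issues its share on a step statement. -/
inductive Issues (src : Fin P.n) (m : Msg P.n V) (s : PState P.n V) : Stmt P.n V → Prop
  | preKeyStep (sq : ℕ) (v : V) (key : Option (Key P.n V)) (hm : m = .preKeyStep sq src v key)
      (hs : (s.lbv sq src).started = true) (ha : (s.lbv sq src).active = true)
      (hn : (s.lbv sq src).sentKeyShare = false) (hu : keyUpToDate s key)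
      (hk : key = none ∨ validKey s key v) : Issues src m s (.preKeyStep sq src v)
  | keyStep (sq : ℕ) (v : V)
      (hm : m = .keyStep sq src v (.full .high (.preKeyStep sq src v))) :
      Issues src m s (.keyStep sq src v)
  | lockStep (sq : ℕ) (v : V)
      (hm : m = .lockStep sq src v (.full .high (.keyStep sq src v)))
      (hs : (s.lbv sq src).started = true) (ha : (s.lbv sq src).active = true) :
      Issues src m s (.lockStep sq src v)

/-- The messages sent after `i` has added those in `out`. -/
abbrev withOutbox (sent : Set (Envelope P.n V)) (i : Fin P.n) (out : Outbox P.n V) :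
    Set (Envelope P.n V) :=
  sent ∪ {e | e.1 = i ∧ e.2 ∈ out}

/-- Turns a fresh share into the guard under which the handler issued it, so that the invariants
below need no further case analysis over messages. -/
theorem signed_receive {sent : Set (Envelope P.n V)} {i src : Fin P.n} {m : Msg P.n V}
    {s : PState P.n V} {x : Stmt P.n V}
    (h : Signed (withOutbox sent i (receive P i src m s).2) i x) :
    Signed sent i x ∨ Issues src m s x := by
  cases x with
  | preKeyStep sq l v =>
    obtain ⟨dst, h | ⟨-, h⟩⟩ := h
    · exact .inl ⟨dst, h⟩
    · refine .inr ?_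
      cases m <;> simp only [receive] at h <;> (repeat' split at h) <;>
        simp_all [toOne, toAll]
      next hc =>
        obtain ⟨-, -, -, rfl, rfl, rfl⟩ := h
        obtain ⟨rfl, h₁, h₂, h₃, h₄, h₅⟩ := hc
        exact .preKeyStep _ _ _ rfl h₁ h₂ h₃ h₄ h₅
  | keyStep sq l v =>
    obtain ⟨dst, h | ⟨-, h⟩⟩ := h
    · exact .inl ⟨dst, h⟩
    · refine .inr ?_
      cases m <;> simp only [receive] at h <;> (repeat' split at h) <;>
        simp_all [toOne, toAll]
      next hc =>
        obtain ⟨-, -, -, rfl, rfl, rfl⟩ := h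
        obtain ⟨rfl, -, -, rfl⟩ := hc
        exact .keyStep _ _ rfl
  | lockStep sq l v =>
    obtain ⟨dst, h | ⟨-, h⟩⟩ := h
    · exact .inl ⟨dst, h⟩
    · refine .inr ?_
      cases m <;> simp only [receive] at h <;> (repeat' split at h) <;>
        simp_all [toOne, toAll]
      next hc =>
        obtain ⟨-, -, -, rfl, rfl, rfl⟩ := h
        obtain ⟨rfl, h₁, h₂, rfl⟩ := hc
        exact .lockStep _ _ rfl h₁ h₂
  | _ => exact .inl trivial

theorem ThreadStep.signed {sent : Set (Envelope P.n V)} {i : Fin P.n} {now : ℝ}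
    {s s' : PState P.n V} {out : Outbox P.n V} (hstep : ThreadStep P i now s s' out)
    {x : Stmt P.n V} (h : Signed (withOutbox sent i out) i x) : Signed sent i x := by
  cases x with
  | preKeyStep sq l v =>
    obtain ⟨dst, h | ⟨-, h⟩⟩ := h
    · exact ⟨dst, h⟩
    · cases hstep <;> simp [toOne, toAll, startOut, helpOut, exchangeOut] at h
  | keyStep sq l v =>
    obtain ⟨dst, h | ⟨-, h⟩⟩ := h
    · exact ⟨dst, h⟩
    · cases hstep <;> simp [toOne, toAll, startOut, helpOut, exchangeOut] at h
  | lockStep sq l v =>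
    obtain ⟨dst, h | ⟨-, h⟩⟩ := h
    · exact ⟨dst, h⟩
    · cases hstep <;> simp [toOne, toAll, startOut, helpOut, exchangeOut] at h
  | _ => trivial

theorem receive_sentKeyShare {i src : Fin P.n} {m : Msg P.n V} {s : PState P.n V} {sq : ℕ}
    {l : Fin P.n} {v : V} (h : Issues src m s (.preKeyStep sq l v)) :
    ((receive P i src m s).1.lbv sq l).sentKeyShare = true := by
  cases h with
  | preKeyStep _ _ key hm hs ha hn hu hk =>
    subst hm
    simp only [receive]
    rw [if_pos ⟨rfl, hs, ha, hn, hu, hk⟩, setLBV_lbv, if_pos ⟨rfl, rfl⟩]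

theorem receive_lockProof {i src : Fin P.n} {m : Msg P.n V} {s : PState P.n V} {sq : ℕ}
    {l : Fin P.n} {v : V} (h : Issues src m s (.lockStep sq l v)) :
    ((receive P i src m s).1.lbv sq l).lockProof ≠ none := by
  cases h with
  | lockStep _ _ hm hs ha =>
    subst hm
    simp only [receive]
    rw [if_pos ⟨rfl, hs, ha, rfl⟩, setLBV_lbv, if_pos ⟨rfl, rfl⟩]
    simp

/-- What holds of the shares that an honest party issued. -/
structure Signing (P : Params V) (byz : Finset (Fin P.n)) (sent : Set (Envelope P.n V))
    (i : Fin P.n) (s : PState P.n V) : Prop where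
  sentKeyShare : ∀ sq l v, Signed sent i (.preKeyStep sq l v) →
    (s.lbv sq l).started = true ∧ (s.lbv sq l).sentKeyShare = true
  unique : ∀ sq l v w, Signed sent i (.preKeyStep sq l v) → Signed sent i (.preKeyStep sq l w) →
    v = w
  keyStep : ∀ sq l v, Signed sent i (.keyStep sq l v) →
    Justified P byz sent (.full .high (.preKeyStep sq l v))
  lockStep : ∀ sq l v, Signed sent i (.lockStep sq l v) →
    Justified P byz sent (.full .high (.keyStep sq l v)) ∧ (s.lbv sq l).lockProof ≠ none
  recent : ∀ sq sq' v w, sq < sq' → Signed sent i (.lockStep sq (P.leaderOf sq) v) →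
    Signed sent i (.preKeyStep sq' (P.leaderOf sq') w) →
    ∃ k, sq ≤ k ∧ k < sq' ∧ Justified P byz sent (.full .high (.preKeyStep k (P.leaderOf k) w))

theorem signing_init (P : Params V) (byz : Finset (Fin P.n)) (i : Fin P.n) :
    Signing P byz ∅ i (PState.init P.n V) := by
  constructor <;> simp [Signed]

theorem Signing.mono {byz : Finset (Fin P.n)} {sent sent' : Set (Envelope P.n V)} {i : Fin P.n}
    {s s' : PState P.n V} (h : Signing P byz sent i s) (hsub : sent ⊆ sent') (hs : Grows s s')
    (hi : ∀ x, Signed sent' i x → Signed sent i x) : Signing P byz sent' i s' where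
  sentKeyShare sq l v hv :=
    (h.sentKeyShare sq l v (hi _ hv)).imp (hs.started sq l) (hs.sentKeyShare sq l)
  unique sq l v w hv hw := h.unique sq l v w (hi _ hv) (hi _ hw)
  keyStep sq l v hv := (h.keyStep sq l v (hi _ hv)).mono hsub
  lockStep sq l v hv := (h.lockStep sq l v (hi _ hv)).imp (.mono hsub) (hs.lockProof sq l)
  recent sq sq' v w hlt hv hw := by
    obtain ⟨k, h₁, h₂, h₃⟩ := h.recent sq sq' v w hlt (hi _ hv) (hi _ hw)
    exact ⟨k, h₁, h₂, h₃.mono hsub⟩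

/-- The flag `sentKeyShare` yields `unique`, and the signature checked by each handler yields
`keyStep` and `lockStep`. The heart is `recent`, where the cases depend on which of the two shares
is new. -/
theorem Signing.receive {byz : Finset (Fin P.n)} {sent : Set (Envelope P.n V)} {i src : Fin P.n}
    {m : Msg P.n V} {s : PState P.n V} (h : Signing P byz sent i s) (hp : Positioned P s)
    (hm : ∀ x ∈ m.sigs, Justified P byz sent x) :
    Signing P byz (withOutbox sent i (receive P i src m s).2) i (receive P i src m s).1 := by
  have hsub : sent ⊆ withOutbox sent i (OptimisticBA.receive P i src m s).2 :=
    Set.subset_union_left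
  have hs : Grows s _ := (receive_frame i src m s).grows
  have ho := hp.ordered
  have hb := bound_le_closed_succ P.n s.loc
  constructor
  · intro sq l v hv
    rcases signed_receive hv with hv | hv
    · exact (h.sentKeyShare sq l v hv).imp (hs.started sq l) (hs.sentKeyShare sq l)
    · refine ⟨hs.started sq l ?_, receive_sentKeyShare hv⟩
      cases hv with
      | preKeyStep _ _ _ _ hst => exact hst
  · intro sq l v w hv hw
    rcases signed_receive hv with hv | hv <;> rcases signed_receive hw with hw | hw
    · exact h.unique sq l v w hv hw
    · cases hw with
      | preKeyStep _ _ _ _ _ _ hn => simp [(h.sentKeyShare sq _ v hv).2] at hn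
    · cases hv with
      | preKeyStep _ _ _ _ _ _ hn => simp [(h.sentKeyShare sq _ w hw).2] at hn
    · cases hv with
      | preKeyStep _ _ _ hm₁ =>
        cases hw with
        | preKeyStep _ _ _ hm₂ => grind
  · intro sq l v hv
    rcases signed_receive hv with hv | hv
    · exact (h.keyStep sq l v hv).mono hsub
    · cases hv with
      | keyStep _ _ hm' =>
        subst hm'
        exact (hm _ rfl).mono hsub
  · intro sq l v hv
    rcases signed_receive hv with hv | hv
    · exact (h.lockStep sq l v hv).imp (.mono hsub) (hs.lockProof sq l)
    · refine ⟨?_, receive_lockProof hv⟩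
      cases hv with
      | lockStep _ _ hm' =>
        subst hm'
        exact (hm _ rfl).mono hsub
  · intro sq sq' v w hlt hv hw
    suffices hk : ∃ k, sq ≤ k ∧ k < sq' ∧
        Justified P byz sent (.full .high (.preKeyStep k (P.leaderOf k) w)) by
      obtain ⟨k, h₁, h₂, h₃⟩ := hk
      exact ⟨k, h₁, h₂, h₃.mono hsub⟩
    rcases signed_receive hw with hw | hw
    · rcases signed_receive hv with hv | hv
      · exact h.recent sq sq' v w hlt hv hw
      -- The view `sq'` was already started, so the older canonical view `sq` is over and can no
      -- longer produce a commit share.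
      · have hlt' := ho.started_lt _ _ (h.sentKeyShare _ _ _ hw).1
        generalize hl : P.leaderOf sq = l at hv
        cases hv with
        | lockStep _ _ _ hst ha =>
          subst hl
          have := ho.inactive sq (by omega) hst
          simp [this] at ha
    · generalize hl : P.leaderOf sq' = l' at hw
      cases hw with
      | preKeyStep _ _ key hm₁ hst ha _ hu hk =>
        subst hl
        -- A key share is issued in an active view only, so `sq'` is not yet closed; being started,
        -- it is the open one, and `sq` lies strictly below `closed`.
        have hclosed : s.loc.closed P.n ≤ sq' := by
          by_contra hcon
          have := ho.inactive sq' (by omega) hst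
          simp [this] at ha
        have hlt' := ho.started_lt _ _ hst
        rcases signed_receive hv with hv | hv
        -- The earlier commit share left a lock of at least `sq`. The accepted key is at least as
        -- recent as this lock, and its leader is recorded, which bounds its number by `closed ≤
        -- sq'`.
        · obtain ⟨lk, hlk, hle⟩ := ho.lock_ge sq (by omega) (h.lockStep _ _ _ hv).2
          obtain ⟨k, hkey, hk'⟩ := hu lk hlk
          rcases hk with rfl | ⟨kq, π, l, rfl, hl, hπ⟩
          · simp at hkey
          · obtain rfl : (kq, π) = k := by simpa using hkey
            obtain ⟨rfl, hkc⟩ := ho.leader _ _ hl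
            refine ⟨kq, hle.trans hk', by omega, ?_⟩
            rw [← (show π = _ from hπ)]
            subst hm₁
            exact hm π ⟨_, rfl, rfl⟩
        -- Both shares cannot be new, since they answer different kinds of messages.
        · generalize hl : P.leaderOf sq = l at hv
          cases hv with
          | lockStep _ _ hm₂ => simp [hm₁] at hm₂

/-! ### The global invariant -/

/-- The invariant of runs. -/
structure Inv (P : Params V) (byz : Finset (Fin P.n)) (g : GState P.n V) : Prop where
  sent : ∀ e ∈ g.sent, ∀ x ∈ e.2.2.sigs, Justified P byz g.sent x
  positioned : ∀ i ∉ byz, Positioned P (g.party i)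
  holds : ∀ i ∉ byz, (g.party i).Holds (Justified P byz g.sent)
  signing : ∀ i ∉ byz, Signing P byz g.sent i (g.party i)

theorem inv_init (P : Params V) (byz : Finset (Fin P.n)) : Inv P byz (GState.init P.n V) where
  sent := by simp [GState.init]
  positioned _ _ := positioned_init P
  holds _ _ := holds_init _
  signing i _ := signing_init P byz i

/-- `Signed` looks only at messages sent by the signer itself, so messages sent by anyone else add
no signature of `i`. -/
theorem Signed.of_ne {n : ℕ} {sent sent' : Set (Envelope n V)} {i : Fin n}
    (h : ∀ e ∈ sent', e.1 = i → e ∈ sent) {x : Stmt n V} (hx : Signed sent' i x) :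
    Signed sent i x := by
  cases x with
  | preKeyStep sq l v => exact hx.imp fun _ hd => h _ hd rfl
  | keyStep sq l v => exact hx.imp fun _ hd => h _ hd rfl
  | lockStep sq l v => exact hx.imp fun _ hd => h _ hd rfl
  | _ => trivial

theorem Inv.apply {byz : Finset (Fin P.n)} {g : GState P.n V} (h : Inv P byz g) {i : Fin P.n}
    {s : PState P.n V} {out : Outbox P.n V} (hp : Positioned P s)
    (hh : s.Holds (Justified P byz (withOutbox g.sent i out)))
    (hs : Signing P byz (withOutbox g.sent i out) i s)
    (hout : ∀ e ∈ out, ∀ x ∈ e.2.sigs, Justified P byz (withOutbox g.sent i out) x) :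
    Inv P byz (g.apply i s out) := by
  have hsub : g.sent ⊆ withOutbox g.sent i out := Set.subset_union_left
  refine ⟨?_, ?_, ?_, ?_⟩
  · rintro e (he | ⟨-, he⟩) x hx
    · exact (h.sent e he x hx).mono hsub
    · exact hout _ he x hx
  · intro j hj
    by_cases hij : j = i
    · subst hij
      simpa [GState.apply] using hp
    · simpa [GState.apply, hij] using h.positioned j hj
  · intro j hj
    by_cases hij : j = i
    · subst hij
      simpa [GState.apply] using hh
    · simpa [GState.apply, hij] using (h.holds j hj).mono fun _ hx => hx.mono hsub
  · intro j hj
    by_cases hij : j = i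
    · subst hij
      simpa [GState.apply] using hs
    · simp only [GState.apply, Function.update_of_ne hij]
      refine (h.signing j hj).mono hsub (.of_eq rfl) fun x => Signed.of_ne ?_
      rintro e (he | ⟨he, -⟩) hej
      · exact he
      · exact absurd (hej.symm.trans he) hij

theorem Step.inv {byz : Finset (Fin P.n)} {g g' : GState P.n V} (hstep : Step P byz g g')
    (h : Inv P byz g) : Inv P byz g' := by
  cases hstep with
  | tick d hd => exact ⟨h.sent, h.positioned, h.holds, h.signing⟩
  | deliver src i m hi hm =>
    have hp := h.positioned i hi
    have hmsg := h.sent _ hm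
    have hsub : g.sent ⊆ withOutbox g.sent i (receive P i src m (g.party i)).2 :=
      Set.subset_union_left
    -- Everything is first transported to the enlarged set of messages, where the fresh shares count
    -- as signed.
    have hh := (h.holds i hi).mono fun _ hx => Justified.mono hsub hx
    have hmsg' := fun x hx => (hmsg x hx).mono hsub
    exact h.apply ((receive_frame i src m _).positioned hp)
      (receive_holds i src m hh (fun sq l hl => (hp.ordered.leader sq l hl).1) hmsg')
      ((h.signing i hi).receive hp hmsg)
      (receive_out_justified hh hmsg' fun e he => .inr ⟨rfl, he⟩)
  | thread i s' out hi ht =>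
    have hp := h.positioned i hi
    have hsub : g.sent ⊆ withOutbox g.sent i out := Set.subset_union_left
    have hh := (h.holds i hi).mono fun _ hx => Justified.mono hsub hx
    have hh' := ht.holds hp hh
    exact h.apply (ht.positioned hp) hh'
      ((h.signing i hi).mono hsub ht.grows fun _ => ht.signed) (ht.out_justified hh hh')
  | byzantine b dst m hb ha =>
    have hsub : g.sent ⊆ insert (b, dst, m) g.sent := Set.subset_insert _ _
    refine ⟨?_, h.positioned, ?_, ?_⟩
    · rintro e (rfl | he) x hx
      · exact ((ha x hx).justified h.sent).mono hsub
      · exact (h.sent e he x hx).mono hsub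
    · exact fun i hi => (h.holds i hi).mono fun _ hx => hx.mono hsub
    · intro i hi
      refine (h.signing i hi).mono hsub (.of_eq rfl) fun x => Signed.of_ne ?_
      rintro e (rfl | he) hei
      · exact absurd (hei ▸ hb) hi
      · exact he

theorem Step.sent_subset {byz : Finset (Fin P.n)} {g g' : GState P.n V}
    (hstep : Step P byz g g') : g.sent ⊆ g'.sent := by
  cases hstep with
  | tick => exact subset_rfl
  | deliver => exact Set.subset_union_left
  | thread => exact Set.subset_union_left
  | byzantine => exact Set.subset_insert _ _

theorem IsRun.inv {byz : Finset (Fin P.n)} {r : ℕ → GState P.n V} (hr : IsRun P byz r) (k : ℕ) :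
    Inv P byz (r k) := by
  induction k with
  | zero => exact hr.1 ▸ inv_init P byz
  | succ k ih => exact (hr.2 k).inv ih

/-! ### Agreement -/

section Agreement

variable {byz : Finset (Fin P.n)} {g : GState P.n V}

/-- Two high threshold signatures have a common honest signer. -/
theorem exists_honest_signer (hbyz : byz.card ≤ P.t) {sent : Set (Envelope P.n V)}
    {m₁ m₂ : Stmt P.n V} (h₁ : Justified P byz sent (.full .high m₁))
    (h₂ : Justified P byz sent (.full .high m₂)) :
    ∃ i ∉ byz, Signed sent i m₁ ∧ Signed sent i m₂ := by
  obtain ⟨Q₁, hQ₁, hS₁⟩ := h₁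
  obtain ⟨Q₂, hQ₂, hS₂⟩ := h₂
  simp only [Params.threshold] at hQ₁ hQ₂
  have hcard := Finset.card_union_add_card_inter Q₁ Q₂
  have hunion : (Q₁ ∪ Q₂).card ≤ P.n := by simpa using Finset.card_le_univ (Q₁ ∪ Q₂)
  have hlt := P.three_mul_t_lt
  -- The intersection has at least `2 (n - t) - n = n - 2t` members, which exceeds `t ≥ byz.card`
  -- because `3t < n`.
  obtain ⟨i, hi, hib⟩ : ∃ i ∈ Q₁ ∩ Q₂, i ∉ byz :=
    Finset.exists_mem_notMem_of_card_lt_card (by omega)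
  rw [Finset.mem_inter] at hi
  exact ⟨i, hib, (hS₁ i hi.1).resolve_left hib, (hS₂ i hi.2).resolve_left hib⟩

theorem Inv.preKeyStep_of_lockStep (h : Inv P byz g) (hbyz : byz.card ≤ P.t) {sq : ℕ}
    {l : Fin P.n} {v : V} (hv : Justified P byz g.sent (.full .high (.lockStep sq l v))) :
    Justified P byz g.sent (.full .high (.preKeyStep sq l v)) := by
  -- Pairing a signature with itself yields a single honest signer of it.
  obtain ⟨i, hi, hs, -⟩ := exists_honest_signer hbyz hv hv
  have hkey := ((h.signing i hi).lockStep _ _ _ hs).1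
  obtain ⟨j, hj, hs', -⟩ := exists_honest_signer hbyz hkey hkey
  exact (h.signing j hj).keyStep _ _ _ hs'

theorem Inv.preKeyStep_unique (h : Inv P byz g) (hbyz : byz.card ≤ P.t) {sq : ℕ} {l : Fin P.n}
    {v w : V} (hv : Justified P byz g.sent (.full .high (.preKeyStep sq l v)))
    (hw : Justified P byz g.sent (.full .high (.preKeyStep sq l w))) : v = w := by
  obtain ⟨i, hi, hs₁, hs₂⟩ := exists_honest_signer hbyz hv hw
  exact (h.signing i hi).unique _ _ _ _ hs₁ hs₂

/-- Once a commit certificate for `v` can exist, all later keys are for `v`. -/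
theorem Inv.preKeyStep_eq (h : Inv P byz g) (hbyz : byz.card ≤ P.t) {sq : ℕ} {v : V}
    (hv : Justified P byz g.sent (.full .high (.lockStep sq (P.leaderOf sq) v))) (sq' : ℕ)
    (hle : sq ≤ sq') {w : V}
    (hw : Justified P byz g.sent (.full .high (.preKeyStep sq' (P.leaderOf sq') w))) :
    v = w := by
  induction sq' using Nat.strong_induction_on with
  | _ sq' ih =>
    rcases hle.eq_or_lt with rfl | hlt
    · exact h.preKeyStep_unique hbyz (h.preKeyStep_of_lockStep hbyz hv) hw
    · obtain ⟨i, hi, hs₁, hs₂⟩ := exists_honest_signer hbyz hv hw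
      obtain ⟨k, h₁, h₂, h₃⟩ := (h.signing i hi).recent sq sq' v w hlt hs₁ hs₂
      exact ih k h₂ h₁ h₃

theorem Inv.lockStep_eq (h : Inv P byz g) (hbyz : byz.card ≤ P.t) {sq sq' : ℕ} {v w : V}
    (hv : Justified P byz g.sent (.full .high (.lockStep sq (P.leaderOf sq) v)))
    (hw : Justified P byz g.sent (.full .high (.lockStep sq' (P.leaderOf sq') w))) : v = w := by
  rcases le_total sq sq' with hle | hle
  · exact h.preKeyStep_eq hbyz hv sq' hle (h.preKeyStep_of_lockStep hbyz hw)
  · exact (h.preKeyStep_eq hbyz hw sq hle (h.preKeyStep_of_lockStep hbyz hv)).symm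

end Agreement

end OptimisticBA

theorem mainTheorem4 {V : Type*} (P : OptimisticBA.Params V)
    (byz : Finset (Fin P.n)) (hbyz : byz.card ≤ P.t)
    (r : ℕ → OptimisticBA.GState P.n V) (hr : OptimisticBA.IsRun P byz r) :
    OptimisticBA.Agreement byz r := by
  rintro i hi j hj v w ⟨k, hv⟩ ⟨k', hw⟩
  -- The two decisions may occur at different times; justification persists as messages accumulate,
  -- so both certificates are compared at the later time.
  have hmono : Monotone fun k => (r k).sent :=
    monotone_nat_of_le_succ fun k => (hr.2 k).sent_subset
  obtain ⟨sq, hv⟩ := ((hr.inv k).holds i hi).decided v hv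
  obtain ⟨sq', hw⟩ := ((hr.inv k').holds j hj).decided w hw
  exact (hr.inv (max k k')).lockStep_eq hbyz (hv.mono (hmono (le_max_left k k')))
    (hw.mono (hmono (le_max_right k k')))
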